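/- There is an absolute constant $C<\infty$ such that the following holds for every positive Borel measure $\sigma$ on $\mathbb{R}$ that is finite on compact sets and has compact support. The Hilbert transform $$(H\sigma)(x)=\lim_{\varepsilon\downarrow 0}\frac1\pi\int_{|x-y|>\varepsilon}\frac{d\sigma(y)}{x-y}$$ exists (as a finite limit) for Lebesgue-almost every $x\in\mathbb{R}$, and, writing $\frac{d\sigma}{dx}$ for the Radon--Nikodym derivative of the absolutely continuous part of $\sigma$ with respect to Lebesgue measure and $$(M\sigma)(x)=\sup_{L>0}\frac{1}{2L}\,\sigma([x-L,x+L])\in[0,\infty]$$ for the Hardy--Littlewood maximal function of $\sigma$, one has $$\int_{\mathbb{R}}\log\Bigl[1+|H\sigma|^2+\bigl(\tfrac{d\sigma}{dx}\bigr)^2\Bigr]dx\;\le\; C\int_{\mathbb{R}}\log\bigl[1+|M\sigma|^2\bigr]dx$$ and $$\int_{\mathbb{R}}\log\bigl[1+|M\sigma|^2\bigr]dx\;\le\; C\int_{\mathbb{R}}\log\Bigl[1+|H\sigma|^2+\bigl(\tfrac{d\sigma}{dx}\bigr)^2\Bigr]dx .$$ -/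

import Mathlib

open MeasureTheory Set Filter Topology
open scoped ENNReal NNReal

noncomputable section

/-- The truncated Hilbert transform `(1/π) ∫_{|x - y| > ε} dσ(y) / (x - y)`. For `ε > 0` and a
finite measure `σ` the integrand is bounded on the domain of integration, so this is a genuine
(convergent) integral. -/
def truncHilbert (σ : Measure ℝ) (ε x : ℝ) : ℝ :=
  (1 / Real.pi) * ∫ y in {y : ℝ | ε < |x - y|}, 1 / (x - y) ∂σ

/-- The Hilbert transform of `σ`: the principal value of the convolution of `σ` with `1 / (π x)`.
(At points where the limit does not exist the value is arbitrary.) -/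
def hilbertTransform (σ : Measure ℝ) (x : ℝ) : ℝ :=
  limUnder (𝓝[>] (0 : ℝ)) (fun ε => truncHilbert σ ε x)

/-- The (centered) Hardy-Littlewood maximal function
`(Mσ)(x) = sup_{L > 0} σ([x - L, x + L]) / (2 L)` of a positive measure, with values in `[0, ∞]`. -/
def maximalFunction (σ : Measure ℝ) (x : ℝ) : ℝ≥0∞ :=
  ⨆ (L : ℝ) (_ : 0 < L), σ (Icc (x - L) (x + L)) / ENNReal.ofReal (2 * L)

/-- The function `t ↦ log (1 + t)` on `[0, ∞]`, with values in `[0, ∞]` and `log (1 + ∞) = ∞`. -/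
def logOneAdd (t : ℝ≥0∞) : ℝ≥0∞ :=
  (ENNReal.log (1 + t)).toENNReal

end

/-! Everything is read off from the Borel transform `w(z) = π⁻¹ ∫ dσ(y)/(y - z)`, which maps the
upper half-plane to its closure and has boundary values `-Hσ + i dσ/dx`. Thus `log (1 + |Hσ|² +
(dσ/dx)²)` is the boundary value of `log (1 + |w|²)`, written `elog w`. Up to constants, `Mσ(x)` is
the supremum of `Im w` over the vertical line above `x`.

Bounding `Mσ` by the boundary values: since `1 - i w` has real part at least 1, the function
`sqrtLog w = L / (1 + L)^{1/2}` with `L = log (1 - i w)` is holomorphic, and its squared modulus is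
comparable to `log (1 + |w|²)`. The Poisson formula from height `δ` and the `L²` maximal theorem
then bound the integral of the vertical supremum of `elog w` by its integral over one horizontal
line (`lintegral_iSup_elog_borelTransform_le`). As `δ → 0` the vertical supremum also serves as the
dominating function. It is integrable because `∫ elog w ≤ 2 σ(ℝ)` on every line
(`lintegral_elog_borelTransform_le`), a consequence of harmonicity of `Re log (1 - i w)`.

Bounding the boundary values by `Mσ`: split `σ` along `Ω = {Mσ > 1}`. The part off `Ω` has maximal
function at most 2 and is handled in `L²`, where `Re w²` harmonic gives `∫ (Re w)² ≤ ∫ (Im w)²`. The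
part on `Ω` has mass at most `7 |Ω|`, so the mass bound for `elog w` applies, and `|Ω|` is
controlled by `∫ log (1 + |Mσ|²)`. The pieces recombine through `elog_add_le`, and Fatou passes to
the boundary.

Existence of the principal value: the vertical supremum bound implies a weak type estimate for `sup
|w|`, so it suffices to have vertical limits for a dense class of measures (Lipschitz densities plus
restrictions to null compact sets). At Lebesgue points, `Re w(x + iε)` and minus the truncated
transform differ by an odd kernel dominated by the Poisson kernel, hence have the same limit. -/

/-! ### Covering lemma and the maximal function of a measure. -/

/-- A version of the Vitali covering lemma on the line, with measures. -/
theorem measure_le_of_vitali {μ ν : Measure ℝ} {A : Set ℝ} {r : ℝ → ℝ} {R : ℝ} {c : ℝ≥0∞}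
    {Ω : Set ℝ} (hr : ∀ x ∈ A, 0 < r x) (hR : ∀ x ∈ A, r x ≤ R)
    (hsub : ∀ x ∈ A, Metric.closedBall x (r x) ⊆ Ω)
    (h : ∀ x ∈ A, μ (Metric.closedBall x (5 * r x)) ≤ c * ν (Metric.closedBall x (r x))) :
    μ A ≤ c * ν Ω := by
  obtain ⟨u, huA, hdisj, hcov⟩ :=
    Vitali.exists_disjoint_subfamily_covering_enlargement_closedBall A id r R hR 5 (by norm_num)
  have hcount : u.Countable := by
    apply hdisj.countable_of_nonempty_interior
    intro x hx
    refine ⟨x, ?_⟩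
    exact interior_mono Metric.ball_subset_closedBall
      (by rw [Metric.isOpen_ball.interior_eq]; exact Metric.mem_ball_self (hr x (huA hx)))
  have hA : A ⊆ ⋃ x ∈ u, Metric.closedBall x (5 * r x) := by
    intro x hx
    obtain ⟨b, hb, hsub⟩ := hcov x hx
    exact mem_biUnion hb (hsub (Metric.mem_closedBall_self (hr x hx).le))
  calc μ A ≤ μ (⋃ x ∈ u, Metric.closedBall x (5 * r x)) := measure_mono hA
    _ ≤ ∑' x : u, μ (Metric.closedBall (x : ℝ) (5 * r x)) := measure_biUnion_le μ hcount _
    _ ≤ ∑' x : u, c * ν (Metric.closedBall (x : ℝ) (r x)) :=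
        ENNReal.tsum_le_tsum fun x => h x (huA x.2)
    _ = c * ∑' x : u, ν (Metric.closedBall (x : ℝ) (r x)) := ENNReal.tsum_mul_left
    _ = c * ν (⋃ x ∈ u, Metric.closedBall x (r x)) := by
        rw [measure_biUnion hcount (by simpa using hdisj)
          fun x _ => Metric.isClosed_closedBall.measurableSet]
    _ ≤ c * ν Ω := by
        gcongr
        exact iUnion₂_subset fun x hx => hsub x (huA hx)

theorem measure_Icc_le_maximalFunction (σ : Measure ℝ) (x : ℝ) {L : ℝ} (hL : 0 < L) :
    σ (Icc (x - L) (x + L)) / ENNReal.ofReal (2 * L) ≤ maximalFunction σ x :=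
  le_iSup₂ (f := fun (L : ℝ) (_ : 0 < L) => σ (Icc (x - L) (x + L)) / ENNReal.ofReal (2 * L)) L hL

theorem measure_Icc_le_of_maximalFunction_le {σ : Measure ℝ} {x : ℝ} {t : ℝ≥0∞}
    (h : maximalFunction σ x ≤ t) {L : ℝ} (hL : 0 < L) :
    σ (Icc (x - L) (x + L)) ≤ t * ENNReal.ofReal (2 * L) := by
  have := (measure_Icc_le_maximalFunction σ x hL).trans h
  rwa [ENNReal.div_le_iff (by simp [hL]) ENNReal.ofReal_ne_top] at this

theorem maximalFunction_mono {σ τ : Measure ℝ} (h : σ ≤ τ) (x : ℝ) :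
    maximalFunction σ x ≤ maximalFunction τ x := by
  unfold maximalFunction
  gcongr

theorem exists_of_lt_maximalFunction {σ : Measure ℝ} {x : ℝ} {t : ℝ≥0∞}
    (h : t < maximalFunction σ x) :
    ∃ L, 0 < L ∧ t * ENNReal.ofReal (2 * L) < σ (Icc (x - L) (x + L)) := by
  simp only [maximalFunction, lt_iSup_iff] at h
  obtain ⟨L, hL, h⟩ := h
  refine ⟨L, hL, ?_⟩
  rwa [ENNReal.lt_div_iff_mul_lt (by simp [hL]) (Or.inl ENNReal.ofReal_ne_top)] at h

/-- Replacing `L` by `L + s` absorbs a displacement of the centre by less than `s`, and for small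
`s` the strict inequality survives. Besides measurability, openness is what makes the distance to
the complement of `{Mσ > 1}` positive on that set. -/
theorem isOpen_lt_maximalFunction (σ : Measure ℝ) (t : ℝ≥0∞) :
    IsOpen {x | t < maximalFunction σ x} := by
  rcases eq_or_ne t ⊤ with rfl | ht
  · simp
  rw [Metric.isOpen_iff]
  intro x hx
  obtain ⟨L, hL, h⟩ := exists_of_lt_maximalFunction hx
  have hc : Tendsto (fun s : ℝ => t * ENNReal.ofReal (2 * (L + s))) (𝓝[>] 0)
      (𝓝 (t * ENNReal.ofReal (2 * L))) := by
    have : Continuous fun s : ℝ => t * ENNReal.ofReal (2 * (L + s)) :=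
      (ENNReal.continuous_const_mul ht).comp (ENNReal.continuous_ofReal.comp (by fun_prop))
    simpa using (this.tendsto 0).mono_left nhdsWithin_le_nhds
  obtain ⟨s, hs, hs0⟩ := ((hc.eventually (gt_mem_nhds h)).and self_mem_nhdsWithin).exists
  refine ⟨s, hs0, fun y hy => ?_⟩
  have hs0 : 0 < s := hs0
  have hy' := abs_lt.1 (Metric.mem_ball.1 hy)
  have hLs : 0 < L + s := by positivity
  refine lt_of_lt_of_le ?_ (measure_Icc_le_maximalFunction σ y hLs)
  rw [ENNReal.lt_div_iff_mul_lt (by simp [hLs]) (Or.inl ENNReal.ofReal_ne_top)]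
  exact hs.trans_le (measure_mono (Icc_subset_Icc (by linarith) (by linarith)))

theorem measurable_maximalFunction (σ : Measure ℝ) : Measurable (maximalFunction σ) :=
  measurable_of_Ioi fun t => (isOpen_lt_maximalFunction σ t).measurableSet

/-- The weak type `(1, 1)` bound for the maximal function. -/
theorem mul_volume_lt_maximalFunction_le (σ : Measure ℝ) (t : ℝ≥0∞) :
    t * volume {x | t < maximalFunction σ x} ≤ 5 * σ univ := by
  rcases eq_or_ne (σ univ) ⊤ with h | h
  · simp [h]
  rcases eq_or_ne t ⊤ with rfl | ht
  · simp
  rcases eq_or_ne t 0 with rfl | ht0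
  · simp
  have ht' : 0 < t.toReal := ENNReal.toReal_pos ht0 ht
  choose! r hr hσ using fun x (hx : x ∈ {x | t < maximalFunction σ x}) =>
    exists_of_lt_maximalFunction hx
  have key : volume {x | t < maximalFunction σ x} ≤ 5 * t⁻¹ * σ univ := by
    refine measure_le_of_vitali (R := (σ univ).toReal / (2 * t.toReal)) (r := r) hr
      (fun x hx => ?_) (fun _ _ => subset_univ _) fun x hx => ?_
    · have h1 := (hσ x hx).le.trans (measure_mono (subset_univ _))
      have h2 := ENNReal.toReal_mono h h1
      rw [ENNReal.toReal_mul, ENNReal.toReal_ofReal (by linarith [hr x hx])] at h2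
      rw [le_div_iff₀ (by positivity)]
      linarith
    · have h1 := (hσ x hx).le
      rw [Real.volume_closedBall, Real.closedBall_eq_Icc]
      calc ENNReal.ofReal (2 * (5 * r x)) = 5 * t⁻¹ * (t * ENNReal.ofReal (2 * r x)) := by
            rw [show 2 * (5 * r x) = 5 * (2 * r x) by ring, ENNReal.ofReal_mul (by norm_num),
              mul_assoc, ← mul_assoc t⁻¹, ENNReal.inv_mul_cancel ht0 ht, one_mul]
            norm_num
        _ ≤ _ := by gcongr
  calc _ ≤ t * (5 * t⁻¹ * σ univ) := by gcongr
    _ = (t * t⁻¹) * (5 * σ univ) := by ring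
    _ = _ := by rw [ENNReal.mul_inv_cancel ht0 ht, one_mul]

theorem ae_maximalFunction_lt_top (σ : Measure ℝ) [IsFiniteMeasure σ] :
    ∀ᵐ x, maximalFunction σ x < ⊤ := by
  have h : ∀ n : ℕ, (n : ℝ≥0∞) * volume {x | maximalFunction σ x = ⊤} ≤ 5 * σ univ := fun n =>
    (mul_le_mul_right (measure_mono fun x (hx : _ = _) => by simp [hx]) _).trans
      (mul_volume_lt_maximalFunction_le σ n)
  have : volume {x | maximalFunction σ x = ⊤} = 0 := by
    by_contra h0
    obtain ⟨n, hn⟩ := ENNReal.exists_nat_mul_gt h0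
      (ENNReal.mul_ne_top (by norm_num : (5 : ℝ≥0∞) ≠ ⊤) (measure_ne_top σ univ))
    exact absurd (h n) (not_le.2 hn)
  rw [ae_iff]
  simpa using this

/-- The superlevel set `{Mσ > 1}` controls the mass of `σ` on it. -/
theorem measure_one_lt_maximalFunction_le (σ : Measure ℝ) [IsFiniteMeasure σ] :
    σ {x | 1 < maximalFunction σ x} ≤ 7 * volume {x | 1 < maximalFunction σ x} := by
  set Ω := {x | 1 < maximalFunction σ x} with hΩ
  have hopen : IsOpen Ω := isOpen_lt_maximalFunction σ 1
  have hfin : volume Ω ≠ ⊤ := by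
    have := mul_volume_lt_maximalFunction_le σ 1
    rw [one_mul] at this
    exact ne_top_of_le_ne_top
      (ENNReal.mul_ne_top (by norm_num : (5 : ℝ≥0∞) ≠ ⊤) (measure_ne_top σ univ)) this
  have hne : (Ωᶜ).Nonempty := by
    by_contra h
    rw [not_nonempty_iff_eq_empty, compl_empty_iff] at h
    rw [h] at hfin
    simp at hfin
  have hsub : ∀ x ∈ Ω, Metric.closedBall x (Metric.infDist x Ωᶜ / 2) ⊆ Ω := by
    intro x hx y hy
    by_contra hy'
    have h1 : Metric.infDist x Ωᶜ ≤ dist x y := Metric.infDist_le_dist_of_mem hy'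
    have h2 : 0 < Metric.infDist x Ωᶜ :=
      (hopen.isClosed_compl.notMem_iff_infDist_pos hne).1 (by simpa using hx)
    rw [Metric.mem_closedBall, dist_comm] at hy
    linarith
  have hpos : ∀ x ∈ Ω, 0 < Metric.infDist x Ωᶜ := fun x hx =>
    (hopen.isClosed_compl.notMem_iff_infDist_pos hne).1 (by simpa using hx)
  refine measure_le_of_vitali (r := fun x => Metric.infDist x Ωᶜ / 2)
    (R := (volume Ω).toReal) (fun x hx => half_pos (hpos x hx)) (fun x hx => ?_) hsub
    fun x hx => ?_
  · have h1 := ENNReal.toReal_mono hfin (measure_mono (μ := volume) (hsub x hx))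
    rw [Real.volume_closedBall, ENNReal.toReal_ofReal (by linarith [hpos x hx])] at h1
    linarith [hpos x hx]
  · obtain ⟨y, hy, hxy⟩ := hopen.isClosed_compl.exists_infDist_eq_dist hne x
    have hy' : maximalFunction σ y ≤ 1 := by simpa [hΩ] using hy
    set d := Metric.infDist x Ωᶜ with hd
    have hd0 : 0 < d := hpos x hx
    -- The nearest point `y` of the complement is at distance `d = 2 (d/2)`, so the ball of radius
    -- `5 (d/2)` about `x` lies in the ball of radius `7 (d/2)` about `y`, where averages are at
    -- most 1.
    have h1 := measure_Icc_le_of_maximalFunction_le hy' (L := 7 * (d / 2)) (by positivity)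
    rw [Real.dist_eq] at hxy
    have h2 := abs_le.1 hxy.ge
    refine (measure_mono ?_).trans (h1.trans_eq ?_)
    · rw [Real.closedBall_eq_Icc]
      exact Icc_subset_Icc (by linarith) (by linarith)
    · rw [Real.volume_closedBall, one_mul, show 2 * (7 * (d / 2)) = 7 * (2 * (d / 2)) by ring,
        ENNReal.ofReal_mul (by norm_num)]
      norm_num

/-- The restriction of `σ` to `{Mσ ≤ 1}` has maximal function at most `2`. -/
theorem maximalFunction_restrict_le_two (σ : Measure ℝ) (x : ℝ) :
    maximalFunction (σ.restrict {x | 1 < maximalFunction σ x}ᶜ) x ≤ 2 := by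
  refine iSup₂_le fun L hL => ?_
  rw [ENNReal.div_le_iff (by simp [hL]) ENNReal.ofReal_ne_top, Measure.restrict_apply
    measurableSet_Icc]
  rcases (Icc (x - L) (x + L) ∩ {x | 1 < maximalFunction σ x}ᶜ).eq_empty_or_nonempty with h | h
  · simp [h]
  · obtain ⟨y, ⟨hy1, hy2⟩, hy⟩ := h
    have hy' : maximalFunction σ y ≤ 1 := by simpa using hy
    -- An interval charged by the restricted measure contains a point `y` with `Mσ(y) ≤ 1`.
    -- Recentring at `y` doubles the radius, which costs the factor 2.
    have h1 := measure_Icc_le_of_maximalFunction_le hy' (L := 2 * L) (by positivity)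
    refine (measure_mono (inter_subset_left.trans ?_)).trans (h1.trans_eq ?_)
    · exact Icc_subset_Icc (by linarith) (by linarith)
    · rw [one_mul, ENNReal.ofReal_mul (p := 2) (by norm_num)]
      norm_num

/-! ### The `L²` maximal theorem by the layer cake formula. -/

theorem sq_eq_lintegral_Ioi (a : ℝ≥0∞) :
    a ^ 2 = ∫⁻ t in Ioi (0 : ℝ), ENNReal.ofReal (2 * t) * (if ENNReal.ofReal t < a then 1 else 0) := by
  have hfin : ∀ b : ℝ, 0 ≤ b → ∫⁻ t in Ioo (0 : ℝ) b, ENNReal.ofReal (2 * t) = ENNReal.ofReal b ^ 2 := by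
    intro b hb
    rw [← ofReal_integral_eq_lintegral_ofReal, ← integral_Ioc_eq_integral_Ioo,
      ← intervalIntegral.integral_of_le hb, intervalIntegral.integral_const_mul, integral_id,
      ← ENNReal.ofReal_pow hb]
    · congr 1; ring
    · exact ((continuous_const.mul continuous_id).integrableOn_Icc (a := 0) (b := b)).mono_set
        Ioo_subset_Icc_self
    · filter_upwards [ae_restrict_mem measurableSet_Ioo] with t ht
      simp only [Pi.zero_apply]; linarith [ht.1]
  have hgen : ∀ (a : ℝ≥0∞) (b : ℝ), 0 ≤ b → ENNReal.ofReal b ≤ a → ENNReal.ofReal b ^ 2 ≤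
      ∫⁻ t in Ioi (0 : ℝ), ENNReal.ofReal (2 * t) * (if ENNReal.ofReal t < a then 1 else 0) := by
    intro a b hb hba
    rw [← hfin b hb, ← lintegral_indicator measurableSet_Ioo, ← lintegral_indicator measurableSet_Ioi]
    refine lintegral_mono fun t => ?_
    by_cases ht : t ∈ Ioo 0 b
    · have h1 : ENNReal.ofReal t < a :=
        ((ENNReal.ofReal_lt_ofReal_iff (ht.1.trans ht.2)).2 ht.2).trans_le hba
      simp [indicator_of_mem ht, indicator_of_mem (show t ∈ Ioi 0 from ht.1), h1]
    · simp [indicator_of_notMem ht]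
  rcases eq_or_ne a ⊤ with rfl | ha
  · symm
    rw [ENNReal.top_pow (by norm_num), eq_top_iff]
    refine ENNReal.le_of_forall_nnreal_lt fun r _ => ?_
    -- The shift by 1 makes `r ≤ (r + 1)²` hold for all `r ≥ 0`.
    have h1 := hgen ⊤ (r + 1) (by positivity) le_top
    refine le_trans ?_ h1
    rw [ENNReal.ofReal_add (by positivity) (by norm_num), ENNReal.ofReal_coe_nnreal,
      ENNReal.ofReal_one]
    norm_cast
    nlinarith [r.2]
  · refine le_antisymm ?_ ?_
    · have := hgen a a.toReal ENNReal.toReal_nonneg (by rw [ENNReal.ofReal_toReal ha])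
      rwa [ENNReal.ofReal_toReal ha] at this
    · have := hfin a.toReal ENNReal.toReal_nonneg
      rw [ENNReal.ofReal_toReal ha] at this
      rw [← this, ← lintegral_indicator measurableSet_Ioo, ← lintegral_indicator measurableSet_Ioi]
      refine lintegral_mono fun t => ?_
      by_cases ht : t ∈ Ioi 0
      · rw [indicator_of_mem ht]
        split_ifs with h
        · rw [indicator_of_mem]
          · simp
          · exact ⟨ht, (ENNReal.ofReal_lt_iff_lt_toReal (le_of_lt ht) ha).1 h⟩
        · simp
      · simp [indicator_of_notMem ht]

/-- The strong type `(2, 2)` bound for the maximal function. -/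
theorem lintegral_maximalFunction_sq_le {F : ℝ → ℝ≥0∞} (hF : Measurable F) :
    ∫⁻ x, maximalFunction (volume.withDensity F) x ^ 2 ≤ 40 * ∫⁻ x, F x ^ 2 := by
  have hlevel : ∀ t : ℝ, 0 < t → ENNReal.ofReal t *
      volume {x | ENNReal.ofReal t < maximalFunction (volume.withDensity F) x} ≤
      10 * ∫⁻ x, if ENNReal.ofReal t < 2 * F x then F x else 0 := by
    intro t ht
    -- Marcinkiewicz truncation at height `t/2`: the discarded part of `F` adds at most `t/2` to the
    -- maximal function, so a value above `t` forces the maximal function of `G` above `t/2`.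
    set G : ℝ → ℝ≥0∞ := fun x => if ENNReal.ofReal t < 2 * F x then F x else 0 with hG
    have hGm : Measurable G :=
      Measurable.ite (measurableSet_lt measurable_const (hF.const_mul 2)) hF measurable_const
    have hle : ∀ x, maximalFunction (volume.withDensity F) x ≤
        maximalFunction (volume.withDensity G) x + ENNReal.ofReal (t / 2) := by
      intro x
      refine iSup₂_le fun L hL => ?_
      have h2L : ENNReal.ofReal (2 * L) ≠ 0 := by simp [hL]
      rw [ENNReal.div_le_iff h2L ENNReal.ofReal_ne_top, add_mul]
      rw [withDensity_apply _ measurableSet_Icc]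
      calc ∫⁻ a in Icc (x - L) (x + L), F a
          ≤ ∫⁻ a in Icc (x - L) (x + L), (G a + ENNReal.ofReal (t / 2)) := by
            refine lintegral_mono fun a => ?_
            simp only [hG]
            split_ifs with h
            · exact le_self_add
            · rw [zero_add, ENNReal.ofReal_div_of_pos (by norm_num),
                ENNReal.le_div_iff_mul_le (by simp) (by simp)]
              rw [mul_comm]
              simpa using h
        _ = (volume.withDensity G) (Icc (x - L) (x + L)) +
              ENNReal.ofReal (t / 2) * ENNReal.ofReal (2 * L) := by
            rw [lintegral_add_left hGm, withDensity_apply _ measurableSet_Icc, setLIntegral_const,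
              Real.volume_Icc]
            congr 3; ring
        _ ≤ _ := by
            gcongr
            exact measure_Icc_le_of_maximalFunction_le le_rfl hL
    have hsub : {x | ENNReal.ofReal t < maximalFunction (volume.withDensity F) x} ⊆
        {x | ENNReal.ofReal (t / 2) < maximalFunction (volume.withDensity G) x} := by
      intro x hx
      have h1 : ENNReal.ofReal t < _ := lt_of_lt_of_le hx (hle x)
      have h2 : ENNReal.ofReal t = ENNReal.ofReal (t / 2) + ENNReal.ofReal (t / 2) := by
        rw [← ENNReal.ofReal_add (by positivity) (by positivity), add_halves]
      rw [h2] at h1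
      exact lt_of_add_lt_add_right h1
    have hw := mul_volume_lt_maximalFunction_le (volume.withDensity G) (ENNReal.ofReal (t / 2))
    rw [withDensity_apply _ MeasurableSet.univ, Measure.restrict_univ] at hw
    calc ENNReal.ofReal t * volume {x | ENNReal.ofReal t < maximalFunction (volume.withDensity F) x}
        ≤ ENNReal.ofReal t *
          volume {x | ENNReal.ofReal (t / 2) < maximalFunction (volume.withDensity G) x} := by
          gcongr
      _ = 2 * (ENNReal.ofReal (t / 2) *
          volume {x | ENNReal.ofReal (t / 2) < maximalFunction (volume.withDensity G) x}) := by
          rw [← mul_assoc, show (2 : ℝ≥0∞) = ENNReal.ofReal 2 by norm_num,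
            ← ENNReal.ofReal_mul (by norm_num)]
          congr 2; ring
      _ ≤ 2 * (5 * ∫⁻ x, G x) := by gcongr
      _ = 10 * ∫⁻ x, G x := by rw [← mul_assoc]; norm_num
  set Mf := maximalFunction (volume.withDensity F) with hMf
  have hMm : Measurable Mf := measurable_maximalFunction _
  have hswap : ∀ H : ℝ → ℝ≥0∞, Measurable H → Measurable (fun p : ℝ × ℝ =>
      ENNReal.ofReal (2 * p.2) * (if ENNReal.ofReal p.2 < H p.1 then (1 : ℝ≥0∞) else 0)) := by
    intro H hH
    refine Measurable.mul (by fun_prop) (Measurable.ite (measurableSet_lt (by fun_prop)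
      (hH.comp measurable_fst)) measurable_const measurable_const)
  calc ∫⁻ x, Mf x ^ 2
      = ∫⁻ x, ∫⁻ t in Ioi (0 : ℝ), ENNReal.ofReal (2 * t) *
          (if ENNReal.ofReal t < Mf x then 1 else 0) := by
        refine lintegral_congr fun x => sq_eq_lintegral_Ioi _
    _ = ∫⁻ t in Ioi (0 : ℝ), ∫⁻ x, ENNReal.ofReal (2 * t) *
          (if ENNReal.ofReal t < Mf x then 1 else 0) :=
        lintegral_lintegral_swap (hswap Mf hMm).aemeasurable
    _ ≤ ∫⁻ t in Ioi (0 : ℝ), ∫⁻ x, 20 * (if ENNReal.ofReal t < 2 * F x then F x else 0) := by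
        refine setLIntegral_mono' measurableSet_Ioi fun t ht => ?_
        have h1 := hlevel t ht
        have hms : MeasurableSet {x | ENNReal.ofReal t < Mf x} :=
          (isOpen_lt_maximalFunction _ _).measurableSet
        rw [lintegral_const_mul' _ _ ENNReal.ofReal_ne_top, lintegral_const_mul' _ _ (by norm_num)]
        have h2 : ∫⁻ x, (if ENNReal.ofReal t < Mf x then (1 : ℝ≥0∞) else 0) =
            volume {x | ENNReal.ofReal t < Mf x} := by
          rw [← lintegral_indicator_one hms]
          exact lintegral_congr fun x => by simp [indicator_apply]
        rw [h2, ENNReal.ofReal_mul (by norm_num), mul_assoc]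
        calc _ ≤ ENNReal.ofReal 2 * (10 * ∫⁻ x, if ENNReal.ofReal t < 2 * F x then F x else 0) := by
              gcongr
          _ = _ := by rw [← mul_assoc]; norm_num
    _ = ∫⁻ x, ∫⁻ t in Ioi (0 : ℝ), 20 * (if ENNReal.ofReal t < 2 * F x then F x else 0) := by
        symm
        refine lintegral_lintegral_swap (Measurable.aemeasurable ?_)
        exact Measurable.const_mul (Measurable.ite (measurableSet_lt (by fun_prop) (by fun_prop))
          (by fun_prop) measurable_const) _
    _ ≤ ∫⁻ x, 40 * F x ^ 2 := by
        refine lintegral_mono fun x => ?_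
        have h1 : ∀ t : ℝ, (20 : ℝ≥0∞) * (if ENNReal.ofReal t < 2 * F x then F x else 0) =
            {t : ℝ | ENNReal.ofReal t < 2 * F x}.indicator (fun _ => 20 * F x) t := by
          intro t
          simp [indicator_apply]
        simp_rw [h1]
        rw [lintegral_indicator_const (measurableSet_lt (by fun_prop) measurable_const)]
        rcases eq_or_ne (F x) ⊤ with hx | hx
        · simp [hx]
        · have h2 : (volume.restrict (Ioi 0)) {t : ℝ | ENNReal.ofReal t < 2 * F x} ≤ 2 * F x := by
            rw [Measure.restrict_apply (measurableSet_lt (by fun_prop) measurable_const)]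
            have h2F : 2 * F x ≠ ⊤ := ENNReal.mul_ne_top (by norm_num) hx
            calc _ ≤ volume (Ioo 0 (2 * F x).toReal) := by
                  refine measure_mono fun t ht => ⟨ht.2, ?_⟩
                  exact (ENNReal.ofReal_lt_iff_lt_toReal (le_of_lt ht.2) h2F).1 ht.1
              _ = 2 * F x := by
                  rw [Real.volume_Ioo, sub_zero, ENNReal.ofReal_toReal h2F]
          calc _ ≤ 20 * F x * (2 * F x) := by gcongr
            _ = _ := by ring
    _ = 40 * ∫⁻ x, F x ^ 2 := lintegral_const_mul' _ _ (by norm_num)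

/-! ### Poisson averages against the maximal function. -/

/-- Dyadic domination of the Poisson kernel by averages over intervals. -/
theorem lintegral_poisson_le_tsum (ν : Measure ℝ) (x : ℝ) {ε : ℝ} (hε : 0 < ε) :
    ∫⁻ y, ENNReal.ofReal (ε / ((y - x) ^ 2 + ε ^ 2)) ∂ν ≤ ∑' k : ℕ, 8 * (2⁻¹ : ℝ≥0∞) ^ k *
      (ν (Icc (x - 2 ^ k * ε) (x + 2 ^ k * ε)) / ENNReal.ofReal (2 * (2 ^ k * ε))) := by
  have hterm : ∀ k : ℕ, 8 * (2⁻¹ : ℝ≥0∞) ^ k *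
      (ν (Icc (x - 2 ^ k * ε) (x + 2 ^ k * ε)) / ENNReal.ofReal (2 * (2 ^ k * ε))) =
      ∫⁻ y, (Icc (x - 2 ^ k * ε) (x + 2 ^ k * ε)).indicator
        (fun _ => ENNReal.ofReal (4 / (4 ^ k * ε))) y ∂ν := by
    intro k
    rw [lintegral_indicator_const measurableSet_Icc, div_eq_mul_inv, mul_comm (ν _), ← mul_assoc]
    congr 1
    rw [show (8 : ℝ≥0∞) = ENNReal.ofReal 8 by norm_num,
      show (2⁻¹ : ℝ≥0∞) = ENNReal.ofReal (2⁻¹) by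
        rw [ENNReal.ofReal_inv_of_pos (by norm_num)]; norm_num,
      ← ENNReal.ofReal_pow (by norm_num), ← ENNReal.ofReal_inv_of_pos (by positivity),
      ← ENNReal.ofReal_mul (by norm_num), ← ENNReal.ofReal_mul (by positivity)]
    congr 1
    rw [show (4 : ℝ) ^ k = 2 ^ k * 2 ^ k by rw [← mul_pow]; norm_num]
    field_simp
    rw [mul_assoc, ← mul_pow]
    norm_num
  simp_rw [hterm]
  rw [← lintegral_tsum fun k => (measurable_const.indicator measurableSet_Icc).aemeasurable]
  refine lintegral_mono fun y => ?_
  obtain ⟨n, hn⟩ : ∃ n : ℕ, |y - x| ≤ 2 ^ n * ε := by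
    obtain ⟨n, hn⟩ := pow_unbounded_of_one_lt (|y - x| / ε) (one_lt_two (α := ℝ))
    exact ⟨n, ((div_lt_iff₀ hε).1 hn).le⟩
  classical
  have hex : ∃ n : ℕ, |y - x| ≤ 2 ^ n * ε := ⟨n, hn⟩
  -- At the first dyadic scale containing `y`, one term of the series already suffices: for `k ≥ 1`
  -- minimality gives `|y - x| > 2^(k-1) ε`, so the Poisson kernel is at most `4 / (4^k ε)`.
  set k := Nat.find hex with hk
  have hkle : |y - x| ≤ 2 ^ k * ε := Nat.find_spec hex
  refine le_trans ?_ (ENNReal.le_tsum k)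
  rw [indicator_of_mem (by rw [mem_Icc]; constructor <;> linarith [abs_le.1 hkle |>.1, abs_le.1 hkle |>.2])]
  apply ENNReal.ofReal_le_ofReal
  rw [div_le_div_iff₀ (by positivity) (by positivity)]
  rcases Nat.eq_zero_or_pos k with h0 | h0
  · rw [h0]; nlinarith [sq_nonneg (y - x), sq_nonneg ε]
  · obtain ⟨j, hj⟩ := Nat.exists_eq_add_of_lt h0
    have hlt : 2 ^ j * ε < |y - x| := by
      have := Nat.find_min hex (m := j) (by omega)
      simpa using this
    have h2 : (2 ^ j * ε) ^ 2 ≤ (y - x) ^ 2 := by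
      rw [← sq_abs (y - x)]
      exact pow_le_pow_left₀ (by positivity) hlt.le 2
    rw [hj, show 0 + j + 1 = j + 1 by ring, pow_succ, show (4 : ℝ) ^ j = (2 ^ j) ^ 2 by
      rw [← pow_mul, mul_comm j 2, pow_mul]; norm_num]
    nlinarith [sq_nonneg ε]

theorem tsum_eight_mul_half_pow : ∑' k : ℕ, 8 * (2⁻¹ : ℝ≥0∞) ^ k = 16 := by
  rw [ENNReal.tsum_mul_left, ENNReal.tsum_geometric, ENNReal.one_sub_inv_two, inv_inv]
  norm_num

theorem lintegral_poisson_le_maximalFunction (ν : Measure ℝ) (x : ℝ) {ε : ℝ} (hε : 0 < ε) :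
    ∫⁻ y, ENNReal.ofReal (ε / ((y - x) ^ 2 + ε ^ 2)) ∂ν ≤ 16 * maximalFunction ν x := by
  refine (lintegral_poisson_le_tsum ν x hε).trans ?_
  rw [← tsum_eight_mul_half_pow, ← ENNReal.tsum_mul_right]
  exact ENNReal.tsum_le_tsum fun k =>
    mul_le_mul_right (measure_Icc_le_maximalFunction ν x (by positivity)) _

/-! ### The Cayley transform and the Poisson formula on the half-plane. -/

theorem Complex.im_I_mul_one_add_div_one_sub (ζ : ℂ) :
    (Complex.I * (1 + ζ) / (1 - ζ)).im = (1 - ‖ζ‖ ^ 2) / ‖1 - ζ‖ ^ 2 := by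
  rw [Complex.div_im, ← Complex.normSq_eq_norm_sq, ← Complex.normSq_eq_norm_sq]
  simp only [Complex.normSq_apply, Complex.mul_re, Complex.mul_im, Complex.I_re, Complex.I_im,
    Complex.add_re, Complex.add_im, Complex.one_re, Complex.one_im, Complex.sub_re, Complex.sub_im]
  ring

theorem Complex.tendsto_I_mul_one_add_div_one_sub :
    Tendsto (fun ζ : ℂ => Complex.I * (1 + ζ) / (1 - ζ)) (𝓝[≠] 1) (cocompact ℂ) := by
  rw [← Metric.cobounded_eq_cocompact, ← tendsto_norm_atTop_iff_cobounded]
  have h1 : Tendsto (fun ζ : ℂ => ‖Complex.I * (1 + ζ)‖) (𝓝[≠] 1) (𝓝 2) := by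
    have : Continuous fun ζ : ℂ => ‖Complex.I * (1 + ζ)‖ := by fun_prop
    have h := (this.tendsto 1).mono_left (nhdsWithin_le_nhds (s := {1}ᶜ))
    have h2 : ‖Complex.I * (1 + 1)‖ = 2 := by
      rw [one_add_one_eq_two]; simp
    rwa [h2] at h
  have h2 : Tendsto (fun ζ : ℂ => ‖1 - ζ‖⁻¹) (𝓝[≠] 1) atTop := by
    refine Tendsto.inv_tendsto_nhdsGT_zero (tendsto_nhdsWithin_iff.2 ⟨?_, ?_⟩)
    · have : Continuous fun ζ : ℂ => ‖1 - ζ‖ := by fun_prop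
      simpa using (this.tendsto 1).mono_left (nhdsWithin_le_nhds (s := {1}ᶜ))
    · filter_upwards [self_mem_nhdsWithin] with ζ hζ
      exact norm_pos_iff.2 (sub_ne_zero.2 (Ne.symm hζ))
  refine (h1.pos_mul_atTop (by norm_num) h2).congr fun ζ => ?_
  rw [norm_div, div_eq_mul_inv]

/-- With `θ = 2 arctan t + π` one has `e^{iθ} = -(1 + it)/(1 - it)`. This parametrizes the unit
circle minus 1 by the real boundary point `t`. -/
theorem Complex.I_mul_one_add_div_one_sub_exp_arctan (t : ℝ) :
    Complex.exp ((2 * Real.arctan t + Real.pi : ℝ) * Complex.I) ≠ 1 ∧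
    Complex.I * (1 + Complex.exp ((2 * Real.arctan t + Real.pi : ℝ) * Complex.I)) /
      (1 - Complex.exp ((2 * Real.arctan t + Real.pi : ℝ) * Complex.I)) = t := by
  have hpos : 0 < 1 + t ^ 2 := by positivity
  have hs : (Real.sqrt (1 + t ^ 2) : ℂ) ^ 2 = 1 + (t : ℂ) ^ 2 := by
    rw [← Complex.ofReal_pow, Real.sq_sqrt hpos.le]; push_cast; ring
  have hs0 : (Real.sqrt (1 + t ^ 2) : ℂ) ≠ 0 := by
    exact_mod_cast (Real.sqrt_pos.2 hpos).ne'
  have hf : (1 : ℂ) + (t : ℂ) ^ 2 = (1 + t * Complex.I) * (1 - t * Complex.I) := by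
    ring_nf; rw [Complex.I_sq]; ring
  have h1 : (1 : ℂ) + t * Complex.I ≠ 0 := fun h => by simpa using congrArg Complex.re h
  have h2 : (1 : ℂ) - t * Complex.I ≠ 0 := fun h => by simpa using congrArg Complex.re h
  have he : Complex.exp ((2 * Real.arctan t + Real.pi : ℝ) * Complex.I) =
      -((1 + t * Complex.I) / (1 - t * Complex.I)) := by
    rw [show ((2 * Real.arctan t + Real.pi : ℝ) : ℂ) * Complex.I =
      (Real.arctan t : ℂ) * Complex.I + (Real.arctan t : ℂ) * Complex.I + Real.pi * Complex.I by
        push_cast; ring, Complex.exp_add, Complex.exp_add, Complex.exp_pi_mul_I,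
      Complex.exp_mul_I, ← Complex.ofReal_cos, ← Complex.ofReal_sin, Real.cos_arctan,
      Real.sin_arctan]
    push_cast
    rw [show (1 / (Real.sqrt (1 + t ^ 2) : ℂ) + t / (Real.sqrt (1 + t ^ 2) : ℂ) * Complex.I) *
      (1 / (Real.sqrt (1 + t ^ 2) : ℂ) + t / (Real.sqrt (1 + t ^ 2) : ℂ) * Complex.I) * -1 =
      -((1 + t * Complex.I) ^ 2 / (Real.sqrt (1 + t ^ 2) : ℂ) ^ 2) by field_simp, hs, hf]
    field_simp
  rw [he]
  constructor
  · intro h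
    have h3 : (2 : ℂ) = 0 := by field_simp at h; linear_combination -h
    norm_num at h3
  · rw [show (1 : ℂ) + -((1 + t * Complex.I) / (1 - t * Complex.I)) =
        -2 * t * Complex.I / (1 - t * Complex.I) by field_simp; ring,
      show (1 : ℂ) - -((1 + t * Complex.I) / (1 - t * Complex.I)) =
        2 / (1 - t * Complex.I) by field_simp; ring,
      div_eq_iff (div_ne_zero two_ne_zero h2), mul_div_assoc', mul_div_assoc']
    congr 1
    linear_combination (-2 * (t : ℂ)) * Complex.I_sq

/-- The Poisson formula at the point `I` of the upper half-plane. -/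
theorem poisson_formula_at_I {k : ℂ → ℂ} (hd : DifferentiableOn ℂ k {z | 0 < z.im})
    (hc : ContinuousOn k {z | 0 ≤ z.im})
    (h0 : Tendsto k (cocompact ℂ ⊓ 𝓟 {z | 0 ≤ z.im}) (𝓝 0)) :
    k Complex.I = ∫ t : ℝ, (Real.pi⁻¹ * (1 + t ^ 2)⁻¹ : ℝ) • k t := by
  -- `c` sends 0 to `I` and the closed disc without 1 to the closed half-plane. Setting `K 1 = 0` is
  -- continuous precisely because `k` vanishes at infinity, so the circle mean value property
  -- applies to `K`.
  set c : ℂ → ℂ := fun ζ => Complex.I * (1 + ζ) / (1 - ζ) with hcdef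
  set K : ℂ → ℂ := fun ζ => if ζ = 1 then 0 else k (c ζ) with hK
  have hcd : ∀ ζ : ℂ, ζ ≠ 1 → DifferentiableAt ℂ c ζ := fun ζ hζ =>
    (((differentiableAt_const _).add differentiableAt_id).const_mul _).div
      ((differentiableAt_const _).sub differentiableAt_id) (sub_ne_zero.2 (Ne.symm hζ))
  have hKeq : ∀ ζ : ℂ, ζ ≠ 1 → K =ᶠ[𝓝 ζ] k ∘ c := fun ζ hζ => by
    filter_upwards [isOpen_ne.mem_nhds hζ] with z hz
    simp [hK, show z ≠ 1 from hz]
  have him : ∀ ζ ∈ Metric.closedBall (0 : ℂ) 1, 0 ≤ (c ζ).im := fun ζ hζ => by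
    rw [hcdef, Complex.im_I_mul_one_add_div_one_sub]
    rw [mem_closedBall_zero_iff] at hζ
    have : ‖ζ‖ ^ 2 ≤ 1 := pow_le_one₀ (norm_nonneg _) hζ
    exact div_nonneg (by linarith) (by positivity)
  have hdiff : DiffContOnCl ℂ K (Metric.ball 0 |1|) := by
    rw [abs_one]
    refine ⟨fun ζ hζ => ?_, ?_⟩
    · have hζ' : ‖ζ‖ < 1 := by simpa using hζ
      have h1 : ζ ≠ 1 := by rintro rfl; simp at hζ'
      refine DifferentiableAt.differentiableWithinAt ?_
      refine DifferentiableAt.congr_of_eventuallyEq ?_ (hKeq ζ h1)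
      refine DifferentiableAt.comp ζ ?_ (hcd ζ h1)
      refine hd.differentiableAt ((isOpen_lt continuous_const Complex.continuous_im).mem_nhds ?_)
      rw [mem_ofPred_eq, hcdef, Complex.im_I_mul_one_add_div_one_sub]
      have : ‖ζ‖ ^ 2 < 1 := pow_lt_one₀ (norm_nonneg _) hζ' (by norm_num)
      have h2 : 0 < ‖1 - ζ‖ := norm_pos_iff.2 (sub_ne_zero.2 (Ne.symm h1))
      exact div_pos (by linarith) (by positivity)
    · rw [closure_ball _ (by norm_num)]
      intro ζ hζ
      by_cases h1 : ζ = 1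
      · subst h1
        rw [← continuousWithinAt_sdiff_self, ContinuousWithinAt]
        have hK1 : K 1 = 0 := by simp [hK]
        rw [hK1]
        have h2 : Tendsto c (𝓝[Metric.closedBall 0 1 \ {1}] 1)
            (cocompact ℂ ⊓ 𝓟 {z | 0 ≤ z.im}) := by
          refine tendsto_inf.2 ⟨?_, tendsto_principal.2 ?_⟩
          · exact Complex.tendsto_I_mul_one_add_div_one_sub.mono_left
              (nhdsWithin_mono _ fun z hz => hz.2)
          · filter_upwards [self_mem_nhdsWithin] with z hz using him z hz.1
        refine (h0.comp h2).congr' ?_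
        filter_upwards [self_mem_nhdsWithin] with z hz
        have hz1 : z ≠ 1 := hz.2
        simp [hK, hz1]
      · refine ContinuousWithinAt.congr_of_eventuallyEq ?_
          ((hKeq ζ h1).filter_mono nhdsWithin_le_nhds) (hKeq ζ h1).eq_of_nhds
        exact ContinuousWithinAt.comp (t := {z | 0 ≤ z.im}) (hc _ (him ζ hζ))
          (hcd ζ h1).continuousAt.continuousWithinAt him
  have havg := hdiff.circleAverage
  have hK0 : K 0 = k Complex.I := by simp [hK, hcdef]
  rw [hK0] at havg
  rw [← havg, Real.circleAverage_def]
  -- Substituting `θ = 2φ + π`, then `φ = arctan t`, turns `dθ / 2π` into `dt / (π (1 + t²))`.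
  have hsub : (∫ θ in (0 : ℝ)..2 * Real.pi, K (circleMap 0 1 θ)) =
      (2 : ℝ) • ∫ φ in (-(Real.pi / 2))..(Real.pi / 2), K (circleMap 0 1 (2 * φ + Real.pi)) := by
    rw [intervalIntegral.integral_comp_mul_add (fun θ => K (circleMap 0 1 θ)) two_ne_zero,
      smul_smul]
    norm_num
    congr 1 <;> ring
  have hrange : Ioo (-(Real.pi / 2)) (Real.pi / 2) = Real.arctan '' univ := by
    rw [image_univ, Real.range_arctan]
  rw [hsub, intervalIntegral.integral_of_le (by linarith [Real.pi_pos]),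
    integral_Ioc_eq_integral_Ioo, hrange,
    integral_image_eq_integral_abs_deriv_smul MeasurableSet.univ
      (fun t _ => (Real.hasDerivAt_arctan t).hasDerivWithinAt) Real.arctan_injective.injOn,
    Measure.restrict_univ, smul_smul, ← integral_smul]
  refine integral_congr_ae (ae_of_all _ fun t => ?_)
  obtain ⟨hne, heq⟩ := Complex.I_mul_one_add_div_one_sub_exp_arctan t
  have h3 : K (circleMap 0 1 (2 * Real.arctan t + Real.pi)) = k t := by
    simp only [hK, circleMap, hcdef, Complex.ofReal_one, one_mul, zero_add]
    rw [if_neg hne, heq]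
  simp only
  rw [h3, smul_smul, abs_of_pos (by positivity)]
  congr 1
  have := Real.pi_pos
  field_simp

/-- The Poisson formula for holomorphic functions on the upper half-plane, with boundary values
taken on the horizontal line at height `δ`. -/
theorem poisson_formula {h : ℂ → ℂ} (hd : DifferentiableOn ℂ h {z | 0 < z.im}) {δ : ℝ}
    (hδ : 0 < δ) (h0 : Tendsto h (cocompact ℂ ⊓ 𝓟 {z | δ ≤ z.im}) (𝓝 0)) (x : ℝ) {ε : ℝ}
    (hε : 0 < ε) :
    h (x + (δ + ε : ℝ) * Complex.I) =
      ∫ t : ℝ, (Real.pi⁻¹ * (ε / ((t - x) ^ 2 + ε ^ 2)) : ℝ) • h (t + δ * Complex.I) := by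
  -- This affine map takes the real axis to the line at height `δ` and `I` to the point `x + i(δ +
  -- ε)`.
  set a : ℂ → ℂ := fun z => x + δ * Complex.I + ε * z with ha
  have haim : ∀ z, (a z).im = δ + ε * z.im := fun z => by simp [ha]
  have had : Differentiable ℂ a := by fun_prop
  have hac : Continuous a := had.continuous
  have hmaps : MapsTo a {z | 0 ≤ z.im} {z | δ ≤ z.im} := fun z hz => by
    have : 0 ≤ z.im := hz
    rw [mem_ofPred_eq, haim]; nlinarith [mul_nonneg hε.le this]
  have hmaps' : MapsTo a {z | 0 ≤ z.im} {z | 0 < z.im} := fun z hz =>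
    lt_of_lt_of_le hδ (hmaps hz)
  have hcoc : Tendsto a (cocompact ℂ) (cocompact ℂ) := by
    have hε' : (ε : ℂ) ≠ 0 := by exact_mod_cast hε.ne'
    exact ((Homeomorph.mulLeft₀ (ε : ℂ) hε').trans
      (Homeomorph.addLeft ((x : ℂ) + δ * Complex.I))).isClosedEmbedding.tendsto_cocompact
  have key := poisson_formula_at_I (k := h ∘ a)
    (hd.comp had.differentiableOn fun z hz => hmaps' (le_of_lt (mem_ofPred_eq ▸ hz)))
    (hd.continuousOn.comp hac.continuousOn hmaps')
    (h0.comp (tendsto_inf.2 ⟨hcoc.mono_left inf_le_left,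
      (tendsto_principal_principal.2 hmaps).mono_left inf_le_right⟩))
  have hI : (h ∘ a) Complex.I = h (x + (δ + ε : ℝ) * Complex.I) := by
    simp only [Function.comp, ha]; congr 1; push_cast; ring
  rw [← hI, key, ← integral_add_right_eq_self (fun t : ℝ =>
    (Real.pi⁻¹ * (ε / ((t - x) ^ 2 + ε ^ 2)) : ℝ) • h (t + δ * Complex.I)) x]
  set F : ℝ → ℂ := fun t => (Real.pi⁻¹ * (ε / (t ^ 2 + ε ^ 2)) : ℝ) •
    h ((t + x : ℝ) + δ * Complex.I) with hF
  have h2 : ∫ s : ℝ, F (ε * s) = |ε⁻¹| • ∫ t : ℝ, F t := Measure.integral_comp_mul_left F ε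
  have h3 : ∫ t : ℝ, F t = ε • ∫ s : ℝ, F (ε * s) := by
    rw [h2, smul_smul, abs_of_pos (inv_pos.2 hε), mul_inv_cancel₀ hε.ne', one_smul]
  have h4 : ∫ t : ℝ, (Real.pi⁻¹ * (ε / ((t + x - x) ^ 2 + ε ^ 2)) : ℝ) •
      h ((t + x : ℝ) + δ * Complex.I) = ∫ t, F t := by simp [hF]
  rw [h4, h3, ← integral_smul]
  refine integral_congr_ae (ae_of_all _ fun t => ?_)
  simp only [hF, smul_smul, Function.comp]
  congr 1
  · have : (0 : ℝ) < 1 + t ^ 2 := by positivity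
    field_simp
    ring
  · simp only [ha]; congr 1; push_cast; ring

theorem integrable_poisson (x : ℝ) {ε : ℝ} (hε : 0 < ε) :
    Integrable (fun t : ℝ => ε / ((t - x) ^ 2 + ε ^ 2)) := by
  have h1 := ((integrable_inv_one_add_sq.comp_mul_left' (inv_ne_zero hε.ne')).comp_sub_right
    x).const_mul ε⁻¹
  refine h1.congr (ae_of_all _ fun t => ?_)
  simp only
  field_simp
  ring

theorem integral_poisson (x : ℝ) {ε : ℝ} (hε : 0 < ε) :
    ∫ t : ℝ, ε / ((t - x) ^ 2 + ε ^ 2) = Real.pi := by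
  rw [integral_sub_right_eq_self (fun t : ℝ => ε / (t ^ 2 + ε ^ 2)) x]
  have h2 := Measure.integral_comp_mul_left (fun t : ℝ => (1 + t ^ 2)⁻¹) ε⁻¹
  rw [integral_univ_inv_one_add_sq, inv_inv, abs_of_pos hε, smul_eq_mul] at h2
  have h3 : ∀ t : ℝ, ε / (t ^ 2 + ε ^ 2) = ε⁻¹ * (1 + (ε⁻¹ * t) ^ 2)⁻¹ := fun t => by
    field_simp
    ring
  simp_rw [h3]
  rw [integral_const_mul, h2]
  field_simp

/-- The radial maximal function of a holomorphic function is dominated by the maximal function of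
its boundary values. -/
theorem enorm_le_maximalFunction {h : ℂ → ℂ} (hd : DifferentiableOn ℂ h {z | 0 < z.im}) {δ : ℝ}
    (hδ : 0 < δ) (h0 : Tendsto h (cocompact ℂ ⊓ 𝓟 {z | δ ≤ z.im}) (𝓝 0)) (x : ℝ) {ε : ℝ}
    (hε : 0 < ε) :
    ‖h (x + (δ + ε : ℝ) * Complex.I)‖ₑ ≤ 16 *
      maximalFunction (volume.withDensity fun t : ℝ => ‖h (t + δ * Complex.I)‖ₑ) x := by
  have hcont : Continuous fun t : ℝ => h (t + δ * Complex.I) :=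
    hd.continuousOn.comp_continuous (by fun_prop) fun t => by simpa using hδ
  rw [poisson_formula hd hδ h0 x hε]
  refine (enorm_integral_le_lintegral_enorm _).trans ?_
  refine le_trans ?_ (lintegral_poisson_le_maximalFunction _ x hε)
  rw [lintegral_withDensity_eq_lintegral_mul _ hcont.enorm.measurable (by fun_prop)]
  refine lintegral_mono fun t => ?_
  rw [enorm_smul, Pi.mul_apply, mul_comm]
  gcongr
  rw [Real.enorm_of_nonneg (by have := Real.pi_pos; positivity)]
  apply ENNReal.ofReal_le_ofReal
  have h1 : Real.pi⁻¹ ≤ 1 := inv_le_one_of_one_le₀ (by linarith [Real.pi_gt_three])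
  have h2 : 0 ≤ ε / ((t - x) ^ 2 + ε ^ 2) := by positivity
  nlinarith

/-- The normalized Poisson weights tend to 1 pointwise, so Fatou's lemma removes them. This converts
information from large heights into a bound for the integral over a whole line. -/
theorem lintegral_le_of_forall_poisson {u : ℝ → ℝ≥0∞} (hu : Measurable u) {b : ℕ → ℝ≥0∞}
    {B : ℝ≥0∞} (hb : Tendsto b atTop (𝓝 B)) (h : ∀ n : ℕ,
      ∫⁻ t, ENNReal.ofReal ((n + 1 : ℝ) ^ 2 / (t ^ 2 + (n + 1 : ℝ) ^ 2)) * u t ≤ b n) :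
    ∫⁻ t, u t ≤ B := by
  have hlim : ∀ t, Tendsto (fun n : ℕ =>
      ENNReal.ofReal ((n + 1 : ℝ) ^ 2 / (t ^ 2 + (n + 1 : ℝ) ^ 2)) * u t) atTop (𝓝 (u t)) := by
    intro t
    have h1 : Tendsto (fun n : ℕ => (n + 1 : ℝ) ^ 2 / (t ^ 2 + (n + 1 : ℝ) ^ 2)) atTop (𝓝 1) := by
      have h2 : Tendsto (fun n : ℕ => t * (1 / ((n : ℝ) + 1))) atTop (𝓝 0) := by
        simpa using tendsto_one_div_add_atTop_nhds_zero_nat.const_mul t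
      have h3 : Tendsto (fun n : ℕ => ((t * (1 / ((n : ℝ) + 1))) ^ 2 + 1)⁻¹) atTop
          (𝓝 ((0 ^ 2 + 1 : ℝ)⁻¹)) := ((h2.pow 2).add_const 1).inv₀ (by norm_num)
      rw [show ((0 : ℝ) ^ 2 + 1)⁻¹ = 1 by norm_num] at h3
      refine h3.congr fun n => ?_
      field_simp
    have h2 := ENNReal.Tendsto.mul_const (b := u t) (ENNReal.tendsto_ofReal h1) (Or.inl (by simp))
    simpa using h2
  calc ∫⁻ t, u t = ∫⁻ t, liminf (fun n : ℕ =>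
        ENNReal.ofReal ((n + 1 : ℝ) ^ 2 / (t ^ 2 + (n + 1 : ℝ) ^ 2)) * u t) atTop :=
        lintegral_congr fun t => (hlim t).liminf_eq.symm
    _ ≤ liminf (fun n : ℕ => ∫⁻ t,
        ENNReal.ofReal ((n + 1 : ℝ) ^ 2 / (t ^ 2 + (n + 1 : ℝ) ^ 2)) * u t) atTop :=
        lintegral_liminf_le fun n => by fun_prop
    _ ≤ B := (liminf_le_liminf (Eventually.of_forall h)).trans hb.liminf_eq.le

/-! ### The Borel transform: holomorphy, decay, real and imaginary parts. -/

/-- The Borel (Cauchy) transform `(1/π) ∫ dσ(y) / (y - z)`, a holomorphic map from the upper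
half-plane to the closed upper half-plane. -/
noncomputable def borelTransform (σ : Measure ℝ) (z : ℂ) : ℂ :=
  (Real.pi : ℂ)⁻¹ * ∫ y : ℝ, ((y : ℂ) - z)⁻¹ ∂σ

section kernel

theorem re_ofReal_add_ofReal_mul_I (a b : ℝ) : ((a : ℂ) + b * Complex.I).re = a := by simp

theorem im_ofReal_add_ofReal_mul_I (a b : ℝ) : ((a : ℂ) + b * Complex.I).im = b := by simp

theorem ofReal_sub_ne_zero {z : ℂ} (hz : 0 < z.im) (y : ℝ) : (y : ℂ) - z ≠ 0 := fun h => by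
  have := congrArg Complex.im h
  simp at this
  exact hz.ne' this

theorem im_le_norm_ofReal_sub (z : ℂ) (y : ℝ) : z.im ≤ ‖(y : ℂ) - z‖ := by
  have := Complex.abs_im_le_norm ((y : ℂ) - z)
  simp only [Complex.sub_im, Complex.ofReal_im, zero_sub, abs_neg] at this
  exact (le_abs_self _).trans this

theorem norm_inv_ofReal_sub_le {z : ℂ} (hz : 0 < z.im) (y : ℝ) :
    ‖((y : ℂ) - z)⁻¹‖ ≤ z.im⁻¹ := by
  rw [norm_inv]
  exact inv_anti₀ hz (im_le_norm_ofReal_sub z y)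

theorem measurable_inv_ofReal_sub (z : ℂ) : Measurable fun y : ℝ => ((y : ℂ) - z)⁻¹ := by
  fun_prop

theorem integrable_inv_ofReal_sub (σ : Measure ℝ) [IsFiniteMeasure σ] {z : ℂ} (hz : 0 < z.im) :
    Integrable (fun y : ℝ => ((y : ℂ) - z)⁻¹) σ :=
  Integrable.of_bound (measurable_inv_ofReal_sub z).aestronglyMeasurable z.im⁻¹
    (ae_of_all _ fun y => norm_inv_ofReal_sub_le hz y)

theorem inv_ofReal_sub_eq (x ε y : ℝ) :
    ((y : ℂ) - (x + ε * Complex.I))⁻¹ =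
      ((y - x) / ((y - x) ^ 2 + ε ^ 2) : ℝ) + (ε / ((y - x) ^ 2 + ε ^ 2) : ℝ) * Complex.I := by
  rw [Complex.inv_def, show (y : ℂ) - (x + ε * Complex.I) = ((y - x : ℝ) : ℂ) +
    ((-ε : ℝ) : ℂ) * Complex.I by push_cast; ring, Complex.normSq_add_mul_I]
  simp only [map_add, Complex.conj_ofReal, map_mul, Complex.conj_I]
  push_cast
  rw [neg_sq]
  ring

end kernel

section transform

variable (σ : Measure ℝ)

theorem norm_borelTransform_le [IsFiniteMeasure σ] {z : ℂ} (hz : 0 < z.im) :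
    ‖borelTransform σ z‖ ≤ Real.pi⁻¹ * (σ.real univ * z.im⁻¹) := by
  rw [borelTransform, norm_mul, norm_inv, Complex.norm_real, Real.norm_of_nonneg Real.pi_pos.le]
  gcongr
  refine (norm_integral_le_of_norm_le_const (ae_of_all _ fun y => norm_inv_ofReal_sub_le hz y)).trans ?_
  rw [mul_comm]

theorem differentiableOn_borelTransform [IsFiniteMeasure σ] :
    DifferentiableOn ℂ (borelTransform σ) {z | 0 < z.im} := by
  intro z hz
  have hz' : 0 < z.im := hz
  refine DifferentiableAt.differentiableWithinAt (DifferentiableAt.const_mul ?_ _)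
  have hball : ∀ w ∈ Metric.ball z (z.im / 2), z.im / 2 ≤ w.im := fun w hw => by
    have h1 := Complex.abs_im_le_norm (w - z)
    rw [Metric.mem_ball, dist_eq_norm] at hw
    rw [Complex.sub_im] at h1
    linarith [(abs_le.1 (h1.trans hw.le)).1]
  refine (hasDerivAt_integral_of_dominated_loc_of_deriv_le (μ := σ)
    (F := fun (z : ℂ) (y : ℝ) => ((y : ℂ) - z)⁻¹)
    (F' := fun (z : ℂ) (y : ℝ) => ((y : ℂ) - z)⁻¹ ^ 2) (bound := fun _ => (z.im / 2)⁻¹ ^ 2)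
    (Metric.ball_mem_nhds z (half_pos hz'))
    (Eventually.of_forall fun w => (measurable_inv_ofReal_sub w).aestronglyMeasurable)
    (integrable_inv_ofReal_sub σ hz')
    ((measurable_inv_ofReal_sub z).pow_const 2).aestronglyMeasurable
    (ae_of_all _ fun y w hw => ?_) (integrable_const _)
    (ae_of_all _ fun y w hw => ?_)).2.differentiableAt
  · rw [norm_pow]
    have h1 := hball w hw
    refine pow_le_pow_left₀ (norm_nonneg _) ?_ 2
    exact (norm_inv_ofReal_sub_le (by linarith) y).trans (inv_anti₀ (by linarith) h1)
  · have h1 := hball w hw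
    have h2 := (((hasDerivAt_id w).const_sub (y : ℂ))).inv (ofReal_sub_ne_zero (z := w) (by linarith) y)
    convert! h2 using 1
    simp [div_eq_inv_mul]

theorem tendsto_borelTransform_cocompact [IsFiniteMeasure σ] {δ : ℝ} (hδ : 0 < δ) :
    Tendsto (borelTransform σ) (cocompact ℂ ⊓ 𝓟 {z | δ ≤ z.im}) (𝓝 0) := by
  have h : Tendsto (fun z : ℂ => ∫ y : ℝ, ((y : ℂ) - z)⁻¹ ∂σ)
      (cocompact ℂ ⊓ 𝓟 {z | δ ≤ z.im}) (𝓝 (∫ _ : ℝ, (0 : ℂ) ∂σ)) := by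
    rw [← Metric.cobounded_eq_cocompact, ← comap_norm_atTop]
    refine tendsto_integral_filter_of_dominated_convergence (fun _ => δ⁻¹)
      (Eventually.of_forall fun w => (measurable_inv_ofReal_sub w).aestronglyMeasurable) ?_
      (integrable_const _) (ae_of_all _ fun y => ?_)
    · filter_upwards [mem_inf_of_right (mem_principal_self _)] with z hz
      have hz' : δ ≤ z.im := hz
      exact ae_of_all _ fun y => (norm_inv_ofReal_sub_le (hδ.trans_le hz') y).trans
        (inv_anti₀ hδ hz')
    · rw [comap_norm_atTop]
      refine Tendsto.mono_left ?_ inf_le_left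
      refine tendsto_inv₀_cobounded.comp ?_
      rw [← tendsto_norm_atTop_iff_cobounded]
      refine tendsto_atTop_mono (fun z => ?_)
        (tendsto_atTop_add_const_right _ (-‖(y : ℂ)‖) tendsto_norm_cobounded_atTop)
      rw [norm_sub_rev]
      exact norm_sub_norm_le z (y : ℂ)
  unfold borelTransform
  simpa using h.const_mul (Real.pi : ℂ)⁻¹

theorem integrable_conjPoisson [IsFiniteMeasure σ] (x : ℝ) {ε : ℝ} (hε : 0 < ε) :
    Integrable (fun y : ℝ => (y - x) / ((y - x) ^ 2 + ε ^ 2)) σ := by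
  have hz : 0 < ((x : ℂ) + ε * Complex.I).im := by simpa using hε
  have hint := integrable_inv_ofReal_sub σ hz
  simp_rw [inv_ofReal_sub_eq] at hint
  exact hint.re.congr (ae_of_all _ fun y => re_ofReal_add_ofReal_mul_I _ _)

theorem integrable_poisson_of_isFiniteMeasure [IsFiniteMeasure σ] (x : ℝ) {ε : ℝ} (hε : 0 < ε) :
    Integrable (fun y : ℝ => ε / ((y - x) ^ 2 + ε ^ 2)) σ := by
  have hz : 0 < ((x : ℂ) + ε * Complex.I).im := by simpa using hε
  have hint := integrable_inv_ofReal_sub σ hz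
  simp_rw [inv_ofReal_sub_eq] at hint
  exact hint.im.congr (ae_of_all _ fun y => im_ofReal_add_ofReal_mul_I _ _)

theorem borelTransform_eq [IsFiniteMeasure σ] (x : ℝ) {ε : ℝ} (hε : 0 < ε) :
    borelTransform σ (x + ε * Complex.I) =
      (Real.pi⁻¹ * ∫ y, (y - x) / ((y - x) ^ 2 + ε ^ 2) ∂σ : ℝ) +
      (Real.pi⁻¹ * ∫ y, ε / ((y - x) ^ 2 + ε ^ 2) ∂σ : ℝ) * Complex.I := by
  rw [borelTransform]
  simp_rw [inv_ofReal_sub_eq]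
  rw [integral_add (integrable_conjPoisson σ x hε).ofReal
    ((integrable_poisson_of_isFiniteMeasure σ x hε).ofReal.mul_const _), integral_mul_const,
    integral_complex_ofReal, integral_complex_ofReal]
  push_cast
  ring

theorem borelTransform_re [IsFiniteMeasure σ] (x : ℝ) {ε : ℝ} (hε : 0 < ε) :
    (borelTransform σ (x + ε * Complex.I)).re =
      Real.pi⁻¹ * ∫ y, (y - x) / ((y - x) ^ 2 + ε ^ 2) ∂σ := by
  rw [borelTransform_eq σ x hε, re_ofReal_add_ofReal_mul_I]

theorem borelTransform_im [IsFiniteMeasure σ] (x : ℝ) {ε : ℝ} (hε : 0 < ε) :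
    (borelTransform σ (x + ε * Complex.I)).im =
      Real.pi⁻¹ * ∫ y, ε / ((y - x) ^ 2 + ε ^ 2) ∂σ := by
  rw [borelTransform_eq σ x hε, im_ofReal_add_ofReal_mul_I]

theorem borelTransform_im_nonneg [IsFiniteMeasure σ] {z : ℂ} (hz : 0 < z.im) :
    0 ≤ (borelTransform σ z).im := by
  rw [← Complex.re_add_im z, borelTransform_im σ z.re hz]
  have := Real.pi_pos
  have : 0 ≤ ∫ y, z.im / ((y - z.re) ^ 2 + z.im ^ 2) ∂σ := integral_nonneg fun y => by positivity
  positivity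

theorem ofReal_borelTransform_im [IsFiniteMeasure σ] (x : ℝ) {ε : ℝ} (hε : 0 < ε) :
    ENNReal.ofReal (borelTransform σ (x + ε * Complex.I)).im =
      ENNReal.ofReal Real.pi⁻¹ * ∫⁻ y, ENNReal.ofReal (ε / ((y - x) ^ 2 + ε ^ 2)) ∂σ := by
  rw [borelTransform_im σ x hε, ENNReal.ofReal_mul (by have := Real.pi_pos; positivity),
    ofReal_integral_eq_lintegral_ofReal (integrable_poisson_of_isFiniteMeasure σ x hε)
      (ae_of_all _ fun y => by positivity)]

theorem ofReal_borelTransform_im_le [IsFiniteMeasure σ] (x : ℝ) {ε : ℝ} (hε : 0 < ε) :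
    ENNReal.ofReal (borelTransform σ (x + ε * Complex.I)).im ≤ 16 * maximalFunction σ x := by
  rw [ofReal_borelTransform_im σ x hε]
  have h1 : ENNReal.ofReal Real.pi⁻¹ ≤ 1 := by
    rw [ENNReal.ofReal_le_one]
    exact inv_le_one_of_one_le₀ (by linarith [Real.pi_gt_three])
  calc _ ≤ 1 * (16 * maximalFunction σ x) :=
        mul_le_mul' h1 (lintegral_poisson_le_maximalFunction σ x hε)
    _ = _ := one_mul _

/-- The kernel `L / ((y - x)² + L²)` is at least `1/(2L)` for `|y - x| ≤ L`, so the average at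
radius `L` is at most `π` times the imaginary part at height `L`; then `π ≤ 4`. -/
theorem maximalFunction_le_iSup_borelTransform_im [IsFiniteMeasure σ] (x : ℝ) :
    maximalFunction σ x ≤ 4 * ⨆ (ε : ℝ) (_ : 0 < ε),
      ENNReal.ofReal (borelTransform σ (x + ε * Complex.I)).im := by
  refine iSup₂_le fun L hL => ?_
  refine le_trans ?_ (mul_le_mul_right (le_iSup₂ (f := fun (ε : ℝ) (_ : 0 < ε) =>
    ENNReal.ofReal (borelTransform σ (x + ε * Complex.I)).im) L hL) 4)
  rw [ofReal_borelTransform_im σ x hL, ENNReal.div_le_iff (by simp [hL]) ENNReal.ofReal_ne_top]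
  have h1 : ENNReal.ofReal (2 * L)⁻¹ * σ (Icc (x - L) (x + L)) ≤
      ∫⁻ y, ENNReal.ofReal (L / ((y - x) ^ 2 + L ^ 2)) ∂σ := by
    rw [← lintegral_indicator_const measurableSet_Icc]
    refine lintegral_mono fun y => ?_
    by_cases hy : y ∈ Icc (x - L) (x + L)
    · rw [indicator_of_mem hy]
      apply ENNReal.ofReal_le_ofReal
      rw [inv_le_comm₀ (by positivity) (by positivity), inv_div, div_le_iff₀ hL]
      nlinarith [hy.1, hy.2]
    · simp [indicator_of_notMem hy]
  calc σ (Icc (x - L) (x + L))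
      = ENNReal.ofReal (2 * L) * (ENNReal.ofReal (2 * L)⁻¹ * σ (Icc (x - L) (x + L))) := by
        rw [← mul_assoc, ← ENNReal.ofReal_mul (by positivity), mul_inv_cancel₀ (by positivity)]
        simp
    _ ≤ ENNReal.ofReal (2 * L) * ((4 * ENNReal.ofReal Real.pi⁻¹) *
          ∫⁻ y, ENNReal.ofReal (L / ((y - x) ^ 2 + L ^ 2)) ∂σ) := by
        refine mul_le_mul_right (h1.trans (le_mul_of_one_le_left' ?_)) _
        rw [show (4 : ℝ≥0∞) = ENNReal.ofReal 4 by norm_num, ← ENNReal.ofReal_mul (by norm_num),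
          ENNReal.one_le_ofReal, ← div_eq_mul_inv, one_le_div Real.pi_pos]
        exact Real.pi_le_four
    _ = _ := by ring

variable {σ}

theorem borelTransform_add [IsFiniteMeasure σ] (τ : Measure ℝ) [IsFiniteMeasure τ] {z : ℂ}
    (hz : 0 < z.im) : borelTransform (σ + τ) z = borelTransform σ z + borelTransform τ z := by
  rw [borelTransform, integral_add_measure (integrable_inv_ofReal_sub σ hz)
    (integrable_inv_ofReal_sub τ hz), mul_add, borelTransform, borelTransform]

theorem borelTransform_smul (c : ℝ≥0) (z : ℂ) :
    borelTransform (c • σ) z = (c : ℝ) * borelTransform σ z := by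
  rw [borelTransform, integral_smul_nnreal_measure, borelTransform]
  simp only [NNReal.smul_def, Complex.real_smul]
  ring

end transform

/-! ### Scalar inequalities for `log (1 - i w)` and `sqrtLog`. -/

section scalar

/-- The function `log (1 - i w)`. -/
noncomputable def logOneSubIMul (w : ℂ) : ℂ := Complex.log (1 - Complex.I * w)

/-- A holomorphic function on the upper half-plane whose squared modulus is comparable to
`log (1 + |w|²)`. -/
noncomputable def sqrtLog (w : ℂ) : ℂ :=
  logOneSubIMul w / (1 + logOneSubIMul w) ^ ((2 : ℕ) : ℂ)⁻¹

variable {w : ℂ}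

theorem one_le_re_one_sub_I_mul (hw : 0 ≤ w.im) : 1 ≤ (1 - Complex.I * w).re := by simpa using hw

theorem one_sub_I_mul_mem_slitPlane (hw : 0 ≤ w.im) : 1 - Complex.I * w ∈ Complex.slitPlane :=
  Or.inl (by linarith [one_le_re_one_sub_I_mul hw])

/-- The difference of the two sides is `2 Im w`. -/
theorem one_add_normSq_le (hw : 0 ≤ w.im) : 1 + ‖w‖ ^ 2 ≤ ‖1 - Complex.I * w‖ ^ 2 := by
  rw [← Complex.normSq_eq_norm_sq, ← Complex.normSq_eq_norm_sq, Complex.normSq_apply,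
    Complex.normSq_apply]
  simp
  nlinarith

theorem logOneSubIMul_re (w : ℂ) : (logOneSubIMul w).re = Real.log ‖1 - Complex.I * w‖ :=
  Complex.log_re _

theorem log_one_add_normSq_le (hw : 0 ≤ w.im) :
    Real.log (1 + ‖w‖ ^ 2) ≤ 2 * (logOneSubIMul w).re := by
  rw [logOneSubIMul_re]
  calc Real.log (1 + ‖w‖ ^ 2) ≤ Real.log (‖1 - Complex.I * w‖ ^ 2) :=
        Real.log_le_log (by positivity) (one_add_normSq_le hw)
    _ = _ := by rw [Real.log_pow]; norm_num

theorem log_one_add_normSq_nonneg (w : ℂ) : 0 ≤ Real.log (1 + ‖w‖ ^ 2) :=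
  Real.log_nonneg (by nlinarith [sq_nonneg ‖w‖])

theorem logOneSubIMul_re_nonneg (hw : 0 ≤ w.im) : 0 ≤ (logOneSubIMul w).re := by
  linarith [log_one_add_normSq_le hw, log_one_add_normSq_nonneg w]

/-- On the convex set `Re z ≥ 1` the derivative of `log` has modulus at most 1; the mean value
inequality is applied between 1 and `1 - i w`. It transfers the decay of the Borel transform to its
logarithm. -/
theorem norm_logOneSubIMul_le (hw : 0 ≤ w.im) : ‖logOneSubIMul w‖ ≤ ‖w‖ := by
  have hconv : Convex ℝ {z : ℂ | 1 ≤ z.re} := convex_halfSpace_re_ge 1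
  have h := hconv.norm_image_sub_le_of_norm_hasDerivWithin_le (𝕜 := ℂ) (f := Complex.log)
    (f' := fun z => z⁻¹) (C := 1) (fun z hz => ?_) (fun z hz => ?_)
    (show (1 : ℂ) ∈ {z : ℂ | 1 ≤ z.re} by simp) (one_le_re_one_sub_I_mul hw)
  · simpa [logOneSubIMul] using h
  · have hz' : 1 ≤ z.re := hz
    exact (Complex.hasDerivAt_log (Or.inl (by linarith))).hasDerivWithinAt
  · have hz' : 1 ≤ z.re := hz
    rw [norm_inv]
    exact inv_le_one_of_one_le₀ (hz'.trans (Complex.re_le_norm z))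

theorem one_add_logOneSubIMul_mem_slitPlane (hw : 0 ≤ w.im) :
    1 + logOneSubIMul w ∈ Complex.slitPlane := by
  refine Or.inl ?_
  rw [Complex.add_re, Complex.one_re]
  linarith [logOneSubIMul_re_nonneg hw]

theorem one_le_norm_one_add_logOneSubIMul (hw : 0 ≤ w.im) : 1 ≤ ‖1 + logOneSubIMul w‖ := by
  refine le_trans ?_ (Complex.re_le_norm _)
  rw [Complex.add_re, Complex.one_re]
  linarith [logOneSubIMul_re_nonneg hw]

theorem norm_logOneSubIMul_le_norm_one_add (hw : 0 ≤ w.im) :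
    ‖logOneSubIMul w‖ ≤ ‖1 + logOneSubIMul w‖ := by
  rw [← abs_of_nonneg (norm_nonneg (logOneSubIMul w)),
    ← abs_of_nonneg (norm_nonneg (1 + logOneSubIMul w)), ← sq_le_sq,
    ← Complex.normSq_eq_norm_sq, ← Complex.normSq_eq_norm_sq, Complex.normSq_apply,
    Complex.normSq_apply]
  simp
  nlinarith [logOneSubIMul_re_nonneg hw]

theorem norm_sqrtLog_sq (w : ℂ) :
    ‖sqrtLog w‖ ^ 2 = ‖logOneSubIMul w‖ ^ 2 / ‖1 + logOneSubIMul w‖ := by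
  rw [sqrtLog, norm_div, div_pow]
  congr 1
  rw [← norm_pow, Complex.cpow_nat_inv_pow _ two_ne_zero]

theorem norm_sqrtLog_le (hw : 0 ≤ w.im) : ‖sqrtLog w‖ ≤ ‖w‖ := by
  refine (pow_le_pow_iff_left₀ (norm_nonneg _) (norm_nonneg _) two_ne_zero).1 ?_
  rw [norm_sqrtLog_sq]
  calc _ ≤ ‖logOneSubIMul w‖ ^ 2 :=
        div_le_self (by positivity) (one_le_norm_one_add_logOneSubIMul hw)
    _ ≤ _ := pow_le_pow_left₀ (norm_nonneg _) (norm_logOneSubIMul_le hw) 2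

/-- Write `ℓ = |log (1 - i w)|`, so that `|w| ≤ e^ℓ - 1`. If `ℓ ≤ 1` then `|w| ≤ 2ℓ` and the
logarithm is at most `4ℓ²`; if `ℓ ≥ 1` it is at most `2ℓ`. Multiplied by `1 + ℓ`, both stay below
`8ℓ²`. -/
theorem log_one_add_normSq_le_sqrtLog (hw : 0 ≤ w.im) :
    Real.log (1 + ‖w‖ ^ 2) ≤ 8 * ‖sqrtLog w‖ ^ 2 := by
  rw [norm_sqrtLog_sq]
  have h1 : ‖1 + logOneSubIMul w‖ ≤ 1 + ‖logOneSubIMul w‖ := by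
    simpa using norm_add_le (1 : ℂ) (logOneSubIMul w)
  have h2 := one_le_norm_one_add_logOneSubIMul hw
  set L := ‖logOneSubIMul w‖ with hL
  have hL0 : 0 ≤ L := norm_nonneg _
  have hexp : ‖w‖ ≤ Real.exp L - 1 := by
    have h3 : Complex.exp (logOneSubIMul w) - 1 = -(Complex.I * w) := by
      rw [logOneSubIMul, Complex.exp_log (Complex.slitPlane_ne_zero (one_sub_I_mul_mem_slitPlane hw))]
      ring
    have h4 : ‖w‖ = ‖Complex.exp (logOneSubIMul w) - 1‖ := by rw [h3]; simp
    rw [h4]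
    simpa using Complex.norm_exp_sub_sum_le_exp_norm_sub_sum (logOneSubIMul w) 1
  rw [mul_div_assoc', le_div_iff₀ (by linarith)]
  have hlog0 := log_one_add_normSq_nonneg w
  refine (mul_le_mul_of_nonneg_left h1 hlog0).trans ?_
  rcases le_total L 1 with hL1 | hL1
  · have h5 : Real.log (1 + ‖w‖ ^ 2) ≤ ‖w‖ ^ 2 := by
      have := Real.log_le_sub_one_of_pos (show 0 < 1 + ‖w‖ ^ 2 by positivity)
      linarith
    have h6 : Real.exp L - 1 ≤ 2 * L := by
      have := Real.abs_exp_sub_one_le (x := L) (by rwa [abs_of_nonneg hL0])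
      rw [abs_of_nonneg hL0] at this
      exact (le_abs_self _).trans this
    have h7 : ‖w‖ ^ 2 ≤ (2 * L) ^ 2 := pow_le_pow_left₀ (norm_nonneg _) (hexp.trans h6) 2
    nlinarith
  · have h5 : Real.log (1 + ‖w‖ ^ 2) ≤ 2 * L := by
      calc Real.log (1 + ‖w‖ ^ 2) ≤ Real.log (Real.exp L ^ 2) := by
            apply Real.log_le_log (by positivity)
            nlinarith [norm_nonneg w, Real.exp_pos L]
        _ = 2 * L := by rw [Real.log_pow, Real.log_exp]; norm_num
    nlinarith

theorem le_two_mul_log_one_add {s : ℝ} (h0 : 0 ≤ s) (h1 : s ≤ 1) : s ≤ 2 * Real.log (1 + s) := by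
  have := Real.one_sub_inv_le_log_of_pos (show 0 < 1 + s by linarith)
  have h2 : 1 - (1 + s)⁻¹ = s / (1 + s) := by field_simp; ring
  have h3 : s / 2 ≤ s / (1 + s) := div_le_div_of_nonneg_left h0 (by linarith) (by linarith)
  linarith

/-- For `|w| ≤ 1` this follows from `|sqrtLog w| ≤ |w|`. For `|w| ≥ 1`, `|sqrtLog w|² ≤ |log (1 - i
w)|`, whose imaginary part is at most `π/2 ≤ 3 log 2` and is absorbed by the logarithm. -/
theorem norm_sqrtLog_sq_le (hw : 0 ≤ w.im) :
    ‖sqrtLog w‖ ^ 2 ≤ 4 * Real.log (1 + ‖w‖ ^ 2) := by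
  rcases le_total ‖w‖ 1 with h1 | h1
  · have h2 := pow_le_pow_left₀ (norm_nonneg _) (norm_sqrtLog_le hw) 2
    have h3 := le_two_mul_log_one_add (sq_nonneg ‖w‖) (pow_le_one₀ (norm_nonneg _) h1)
    linarith [log_one_add_normSq_nonneg w]
  · have hf : ‖sqrtLog w‖ ^ 2 ≤ ‖logOneSubIMul w‖ := by
      rw [norm_sqrtLog_sq, div_le_iff₀ (by linarith [one_le_norm_one_add_logOneSubIMul hw]), sq]
      exact mul_le_mul_of_nonneg_left (norm_logOneSubIMul_le_norm_one_add hw) (norm_nonneg _)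
    have him : |(logOneSubIMul w).im| ≤ Real.pi / 2 := by
      rw [logOneSubIMul, Complex.log_im, Complex.abs_arg_le_pi_div_two_iff]
      linarith [one_le_re_one_sub_I_mul hw]
    have hre : |(logOneSubIMul w).re| ≤ Real.log (1 + ‖w‖ ^ 2) := by
      rw [abs_of_nonneg (logOneSubIMul_re_nonneg hw), logOneSubIMul_re]
      have hn : ‖1 - Complex.I * w‖ ≤ 1 + ‖w‖ := by
        simpa using norm_sub_le (1 : ℂ) (Complex.I * w)
      refine Real.log_le_log (by linarith [Complex.re_le_norm (1 - Complex.I * w), one_le_re_one_sub_I_mul hw]) ?_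
      nlinarith
    have hlog2 : Real.log 2 ≤ Real.log (1 + ‖w‖ ^ 2) :=
      Real.log_le_log (by norm_num) (by nlinarith)
    linarith [Complex.norm_le_abs_re_add_abs_im (logOneSubIMul w), Real.log_two_gt_d9,
      Real.pi_lt_d2]

end scalar

/-- `log (1 + |w|²)` as an extended nonnegative real. -/
noncomputable def elog (w : ℂ) : ℝ≥0∞ := ENNReal.ofReal (Real.log (1 + ‖w‖ ^ 2))

theorem continuous_elog : Continuous elog := by
  refine ENNReal.continuous_ofReal.comp (Continuous.log (by fun_prop) fun w => ?_)
  positivity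

theorem elog_le_sqrtLog {w : ℂ} (hw : 0 ≤ w.im) : elog w ≤ 8 * ‖sqrtLog w‖ₑ ^ 2 := by
  rw [← ofReal_norm, ← ENNReal.ofReal_pow (norm_nonneg _),
    show (8 : ℝ≥0∞) = ENNReal.ofReal 8 by norm_num, ← ENNReal.ofReal_mul (by norm_num)]
  exact ENNReal.ofReal_le_ofReal (log_one_add_normSq_le_sqrtLog hw)

theorem sqrtLog_le_elog {w : ℂ} (hw : 0 ≤ w.im) : ‖sqrtLog w‖ₑ ^ 2 ≤ 4 * elog w := by
  rw [← ofReal_norm, ← ENNReal.ofReal_pow (norm_nonneg _), elog,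
    show (4 : ℝ≥0∞) = ENNReal.ofReal 4 by norm_num, ← ENNReal.ofReal_mul (by norm_num)]
  exact ENNReal.ofReal_le_ofReal (norm_sqrtLog_sq_le hw)

/-- From `1 + |v + w|² ≤ (1 + 2|v|²)(1 + |w|²)²` and `log (1 + s) ≤ s`. The asymmetry fits the
splitting of `σ`: `v` will be controlled in `L²`, `w` only logarithmically. -/
theorem elog_add_le (v w : ℂ) : elog (v + w) ≤ 2 * ‖v‖ₑ ^ 2 + 2 * elog w := by
  have h1 : ‖v + w‖ ≤ ‖v‖ + ‖w‖ := norm_add_le v w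
  have h2 : 1 + ‖v + w‖ ^ 2 ≤ (1 + 2 * ‖v‖ ^ 2) * (1 + ‖w‖ ^ 2) ^ 2 := by
    have h3 : ‖v + w‖ ^ 2 ≤ (‖v‖ + ‖w‖) ^ 2 := pow_le_pow_left₀ (norm_nonneg _) h1 2
    have h4 : (0 : ℝ) ≤ ‖v‖ ^ 2 * ‖w‖ ^ 2 := by positivity
    have h5 : (0 : ℝ) ≤ ‖v‖ ^ 2 * (‖w‖ ^ 2) ^ 2 := by positivity
    nlinarith [sq_nonneg (‖v‖ - ‖w‖), sq_nonneg (‖w‖ ^ 2)]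
  have h6 : Real.log (1 + ‖v + w‖ ^ 2) ≤ 2 * ‖v‖ ^ 2 + 2 * Real.log (1 + ‖w‖ ^ 2) := by
    refine (Real.log_le_log (by positivity) h2).trans ?_
    rw [Real.log_mul (by positivity) (by positivity), Real.log_pow]
    have := Real.log_le_sub_one_of_pos (show 0 < 1 + 2 * ‖v‖ ^ 2 by positivity)
    push_cast
    linarith
  rw [elog, ← ofReal_norm v, ← ENNReal.ofReal_pow (norm_nonneg _), elog,
    show (2 : ℝ≥0∞) = ENNReal.ofReal 2 by norm_num, ← ENNReal.ofReal_mul (by norm_num),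
    ← ENNReal.ofReal_mul (by norm_num),
    ← ENNReal.ofReal_add (by positivity) (by linarith [log_one_add_normSq_nonneg w])]
  exact ENNReal.ofReal_le_ofReal h6

/-! ### Integral bounds on horizontal lines. -/

theorem poisson_formula_re {h : ℂ → ℂ} (hd : DifferentiableOn ℂ h {z | 0 < z.im}) {δ : ℝ}
    (hδ : 0 < δ) (h0 : Tendsto h (cocompact ℂ ⊓ 𝓟 {z | δ ≤ z.im}) (𝓝 0)) {B : ℝ}
    (hB : ∀ t : ℝ, ‖h (t + δ * Complex.I)‖ ≤ B) {ε : ℝ} (hε : 0 < ε) :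
    ∫ t : ℝ, ε ^ 2 / (t ^ 2 + ε ^ 2) * (h (t + δ * Complex.I)).re =
      Real.pi * ε * (h ((δ + ε : ℝ) * Complex.I)).re := by
  have hcont : Continuous fun t : ℝ => h (t + δ * Complex.I) :=
    hd.continuousOn.comp_continuous (by fun_prop) fun t => by simpa using hδ
  have hp := poisson_formula hd hδ h0 0 hε
  have hint : Integrable fun t : ℝ =>
      (Real.pi⁻¹ * (ε / ((t - 0) ^ 2 + ε ^ 2)) : ℝ) • h (t + δ * Complex.I) :=
    ((integrable_poisson 0 hε).const_mul _).smul_bdd B hcont.aestronglyMeasurable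
      (ae_of_all _ hB)
  have hre := congrArg Complex.re hp
  rw [← RCLike.re_eq_complex_re, ← integral_re hint] at hre
  simp only [RCLike.re_eq_complex_re, Complex.ofReal_zero, zero_add, sub_zero] at hre
  rw [hre, ← integral_const_mul]
  refine integral_congr_ae (ae_of_all _ fun t => ?_)
  have := Real.pi_pos
  have h2 : 0 < t ^ 2 + ε ^ 2 := by positivity
  simp only [Complex.real_smul, Complex.re_ofReal_mul]
  field_simp

section finite

variable (σ : Measure ℝ) [IsFiniteMeasure σ]

theorem continuous_borelTransform_line {δ : ℝ} (hδ : 0 < δ) :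
    Continuous fun t : ℝ => borelTransform σ (t + δ * Complex.I) :=
  (differentiableOn_borelTransform σ).continuousOn.comp_continuous (by fun_prop)
    fun t => by simpa using hδ

theorem differentiableOn_logOneSubIMul_borelTransform :
    DifferentiableOn ℂ (fun z => logOneSubIMul (borelTransform σ z)) {z | 0 < z.im} := fun z hz =>
  ((((differentiableOn_borelTransform σ z hz).const_mul _).const_sub _).clog
    (one_sub_I_mul_mem_slitPlane (borelTransform_im_nonneg σ hz)))

theorem differentiableOn_sqrtLog_borelTransform :
    DifferentiableOn ℂ (fun z => sqrtLog (borelTransform σ z)) {z | 0 < z.im} := fun z hz => by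
  have h1 := differentiableOn_logOneSubIMul_borelTransform σ z hz
  have h2 := one_add_logOneSubIMul_mem_slitPlane (borelTransform_im_nonneg σ hz)
  refine h1.div ((h1.const_add 1).cpow (differentiableWithinAt_const _) h2) ?_
  rw [Complex.cpow_ne_zero_iff]
  exact Or.inl (Complex.slitPlane_ne_zero h2)

theorem tendsto_comp_borelTransform {φ : ℂ → ℂ} (hφ : ∀ w : ℂ, 0 ≤ w.im → ‖φ w‖ ≤ ‖w‖) {δ : ℝ}
    (hδ : 0 < δ) : Tendsto (fun z => φ (borelTransform σ z))
      (cocompact ℂ ⊓ 𝓟 {z | δ ≤ z.im}) (𝓝 0) := by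
  refine squeeze_zero_norm' ?_ (by simpa using (tendsto_borelTransform_cocompact σ hδ).norm)
  filter_upwards [mem_inf_of_right (mem_principal_self _)] with z hz
  exact hφ _ (borelTransform_im_nonneg σ (hδ.trans_le hz))

theorem norm_borelTransform_line_le {δ : ℝ} (hδ : 0 < δ) (t : ℝ) :
    ‖borelTransform σ (t + δ * Complex.I)‖ ≤ Real.pi⁻¹ * (σ.real univ * δ⁻¹) := by
  have := norm_borelTransform_le σ (z := t + δ * Complex.I) (by simpa using hδ)
  simpa using this

theorem borelTransform_line_im_nonneg {δ : ℝ} (hδ : 0 < δ) (t : ℝ) :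
    0 ≤ (borelTransform σ (t + δ * Complex.I)).im :=
  borelTransform_im_nonneg σ (by simpa using hδ)

/-- `Re log (1 - i w)` is nonnegative and harmonic, so its weighted integrals equal `π n` times its
value at height `δ + n`. That value is at most `|w| ≤ σ(ℝ) / (π (δ + n))`, so they never exceed
`σ(ℝ)`. -/
theorem lintegral_elog_borelTransform_le {δ : ℝ} (hδ : 0 < δ) :
    ∫⁻ t : ℝ, elog (borelTransform σ (t + δ * Complex.I)) ≤ 2 * σ univ := by
  have hm := continuous_borelTransform_line σ hδ
  set F : ℂ → ℂ := fun z => logOneSubIMul (borelTransform σ z) with hF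
  have hFd := differentiableOn_logOneSubIMul_borelTransform σ
  have hFc : Continuous fun t : ℝ => (F (t + δ * Complex.I)).re :=
    Complex.continuous_re.comp
      (hFd.continuousOn.comp_continuous (by fun_prop) fun t => by simpa using hδ)
  have hF0 : ∀ t : ℝ, 0 ≤ (F (t + δ * Complex.I)).re := fun t =>
    logOneSubIMul_re_nonneg (borelTransform_line_im_nonneg σ hδ t)
  have hFB : ∀ t : ℝ, ‖F (t + δ * Complex.I)‖ ≤ Real.pi⁻¹ * (σ.real univ * δ⁻¹) := fun t =>
    (norm_logOneSubIMul_le (borelTransform_line_im_nonneg σ hδ t)).trans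
      (norm_borelTransform_line_le σ hδ t)
  have key : ∫⁻ t : ℝ, ENNReal.ofReal (F (t + δ * Complex.I)).re ≤ σ univ := by
    refine lintegral_le_of_forall_poisson hFc.measurable.ennreal_ofReal
      (tendsto_const_nhds (x := σ univ)) fun n => ?_
    have hn : (0 : ℝ) < n + 1 := by positivity
    have hp := poisson_formula_re hFd hδ
      (tendsto_comp_borelTransform σ (fun w hw => norm_logOneSubIMul_le hw) hδ) hFB hn
    have hmul : ∀ t : ℝ, ENNReal.ofReal ((n + 1 : ℝ) ^ 2 / (t ^ 2 + (n + 1 : ℝ) ^ 2)) *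
        ENNReal.ofReal (F (t + δ * Complex.I)).re =
        ENNReal.ofReal ((n + 1 : ℝ) ^ 2 / (t ^ 2 + (n + 1 : ℝ) ^ 2) *
          (F (t + δ * Complex.I)).re) := fun t => (ENNReal.ofReal_mul (by positivity)).symm
    rw [lintegral_congr hmul, ← ofReal_integral_eq_lintegral_ofReal]
    · change ENNReal.ofReal (∫ t : ℝ, (n + 1 : ℝ) ^ 2 / (t ^ 2 + (n + 1 : ℝ) ^ 2) *
        (logOneSubIMul (borelTransform σ (t + δ * Complex.I))).re) ≤ _
      rw [hp, ← ENNReal.ofReal_toReal (measure_ne_top σ univ)]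
      apply ENNReal.ofReal_le_ofReal
      have hpos : 0 < δ + (n + 1 : ℝ) := by positivity
      have h1 := norm_borelTransform_line_le σ hpos 0
      have h2 := borelTransform_line_im_nonneg σ hpos 0
      have h3 := (Complex.re_le_norm _).trans ((norm_logOneSubIMul_le h2).trans h1)
      rw [Complex.ofReal_zero, zero_add] at h3
      have hσ : 0 ≤ σ.real univ := measureReal_nonneg
      calc _ ≤ Real.pi * (n + 1 : ℝ) * (Real.pi⁻¹ * (σ.real univ * (δ + (n + 1 : ℝ))⁻¹)) := by
            gcongr
        _ = σ.real univ * ((n + 1 : ℝ) / (δ + (n + 1 : ℝ))) := by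
            have := Real.pi_pos
            field_simp
        _ ≤ σ.real univ * 1 := by
            gcongr
            rw [div_le_one hpos]; linarith
        _ = (σ univ).toReal := by rw [mul_one]; rfl
    · have h1 := ((integrable_poisson 0 hn).const_mul (n + 1 : ℝ)).mul_bdd
        hFc.aestronglyMeasurable (ae_of_all _ fun t => (Complex.abs_re_le_norm _).trans (hFB t))
      refine h1.congr (ae_of_all _ fun t => ?_)
      simp only [sub_zero]
      ring
    · exact ae_of_all _ fun t => mul_nonneg (by positivity) (hF0 t)
  calc _ ≤ ∫⁻ t : ℝ, 2 * ENNReal.ofReal (F (t + δ * Complex.I)).re := by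
        refine lintegral_mono fun t => ?_
        rw [show (2 : ℝ≥0∞) = ENNReal.ofReal 2 by norm_num, ← ENNReal.ofReal_mul (by norm_num)]
        exact ENNReal.ofReal_le_ofReal
          (log_one_add_normSq_le (borelTransform_line_im_nonneg σ hδ t))
    _ ≤ _ := by
        rw [lintegral_const_mul' _ _ (by norm_num)]
        gcongr

/-- `Re w² = (Re w)² - (Im w)²` is harmonic and `O(n⁻²)` at height `n`, so its Poisson-weighted
integral, at most `π n · O(n⁻²)`, contributes nothing in the limit. -/
theorem lintegral_re_sq_borelTransform_le {δ : ℝ} (hδ : 0 < δ) :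
    ∫⁻ t : ℝ, ENNReal.ofReal ((borelTransform σ (t + δ * Complex.I)).re ^ 2) ≤
      ∫⁻ t : ℝ, ENNReal.ofReal ((borelTransform σ (t + δ * Complex.I)).im ^ 2) := by
  have hm := continuous_borelTransform_line σ hδ
  set D := Real.pi⁻¹ * σ.real univ with hD
  have hD0 : 0 ≤ D := by have := Real.pi_pos; positivity
  have hwd := differentiableOn_borelTransform σ
  have hFB : ∀ t : ℝ, ‖borelTransform σ (t + δ * Complex.I)‖ ≤ D * δ⁻¹ := fun t => by
    simpa [hD, mul_assoc] using norm_borelTransform_line_le σ hδ t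
  have hFB2 : ∀ t : ℝ, ‖borelTransform σ (t + δ * Complex.I) ^ 2‖ ≤ (D * δ⁻¹) ^ 2 := fun t => by
    rw [norm_pow]
    exact pow_le_pow_left₀ (norm_nonneg _) (hFB t) 2
  have hlim : Tendsto (fun z => borelTransform σ z ^ 2) (cocompact ℂ ⊓ 𝓟 {z | δ ≤ z.im}) (𝓝 0) := by
    simpa using (tendsto_borelTransform_cocompact σ hδ).pow 2
  have hb : Tendsto (fun n : ℕ => ENNReal.ofReal (Real.pi * D ^ 2 * (1 / ((n : ℝ) + 1))) +
      ∫⁻ t : ℝ, ENNReal.ofReal ((borelTransform σ (t + δ * Complex.I)).im ^ 2)) atTop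
      (𝓝 (∫⁻ t : ℝ, ENNReal.ofReal ((borelTransform σ (t + δ * Complex.I)).im ^ 2))) := by
    have h1 := ENNReal.tendsto_ofReal
      (tendsto_one_div_add_atTop_nhds_zero_nat.const_mul (Real.pi * D ^ 2))
    simpa using h1.add_const (∫⁻ t : ℝ, ENNReal.ofReal ((borelTransform σ (t + δ * Complex.I)).im ^ 2))
  refine lintegral_le_of_forall_poisson
    ((Complex.continuous_re.comp hm).pow 2).measurable.ennreal_ofReal hb fun n => ?_
  have hn : (0 : ℝ) < n + 1 := by positivity
  have hp := poisson_formula_re (hwd.fun_pow 2) hδ hlim hFB2 hn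
  set P : ℝ → ℝ := fun t => (n + 1 : ℝ) ^ 2 / (t ^ 2 + (n + 1 : ℝ) ^ 2) with hP
  have hP0 : ∀ t, 0 ≤ P t := fun t => by positivity
  have hP1 : ∀ t, P t ≤ 1 := fun t => by
    rw [hP]
    exact div_le_one_of_le₀ (by nlinarith) (by positivity)
  have hPint : Integrable P := by
    refine ((integrable_poisson 0 hn).const_mul (n + 1 : ℝ)).congr (ae_of_all _ fun t => ?_)
    simp only [sub_zero, hP]
    ring
  have hre : Integrable fun t : ℝ => P t * (borelTransform σ (t + δ * Complex.I)).re ^ 2 := by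
    refine hPint.mul_bdd (c := (D * δ⁻¹) ^ 2)
      ((Complex.continuous_re.comp hm).pow 2).aestronglyMeasurable (ae_of_all _ fun t => ?_)
    rw [norm_pow]
    exact pow_le_pow_left₀ (norm_nonneg _) ((Complex.abs_re_le_norm _).trans (hFB t)) 2
  have him : Integrable fun t : ℝ => P t * (borelTransform σ (t + δ * Complex.I)).im ^ 2 := by
    refine hPint.mul_bdd (c := (D * δ⁻¹) ^ 2)
      ((Complex.continuous_im.comp hm).pow 2).aestronglyMeasurable (ae_of_all _ fun t => ?_)
    rw [norm_pow]
    exact pow_le_pow_left₀ (norm_nonneg _) ((Complex.abs_im_le_norm _).trans (hFB t)) 2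
  have hsum : ∫ t : ℝ, P t * (borelTransform σ (t + δ * Complex.I)).re ^ 2 =
      Real.pi * (n + 1) * (borelTransform σ ((δ + (n + 1) : ℝ) * Complex.I) ^ 2).re +
      ∫ t : ℝ, P t * (borelTransform σ (t + δ * Complex.I)).im ^ 2 := by
    rw [← hp, ← integral_add _ him]
    · refine integral_congr_ae (ae_of_all _ fun t => ?_)
      simp only [hP, sq, Complex.mul_re]
      ring
    · refine (hre.sub him).congr (ae_of_all _ fun t => ?_)
      simp only [Pi.sub_apply, hP, sq, Complex.mul_re]
      ring
  have hmain : Real.pi * (n + 1) * (borelTransform σ ((δ + (n + 1) : ℝ) * Complex.I) ^ 2).re ≤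
      Real.pi * D ^ 2 * (1 / ((n : ℝ) + 1)) := by
    have hpos : 0 < δ + (n + 1 : ℝ) := by positivity
    have h1 : ‖borelTransform σ ((δ + (n + 1) : ℝ) * Complex.I)‖ ≤ D * (δ + (n + 1 : ℝ))⁻¹ := by
      simpa [hD, mul_assoc] using norm_borelTransform_line_le σ hpos 0
    have h2 : (δ + (n + 1 : ℝ))⁻¹ ≤ (n + 1 : ℝ)⁻¹ := inv_anti₀ hn (by linarith)
    have h3 : (borelTransform σ ((δ + (n + 1) : ℝ) * Complex.I) ^ 2).re ≤
        (D * (n + 1 : ℝ)⁻¹) ^ 2 := by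
      refine (Complex.re_le_norm _).trans ?_
      rw [norm_pow]
      exact pow_le_pow_left₀ (norm_nonneg _) (h1.trans (by gcongr)) 2
    calc _ ≤ Real.pi * (n + 1) * (D * (n + 1 : ℝ)⁻¹) ^ 2 := by
          gcongr
      _ = _ := by field_simp
  have hmul : ∀ t : ℝ, ENNReal.ofReal ((n + 1 : ℝ) ^ 2 / (t ^ 2 + (n + 1 : ℝ) ^ 2)) *
      ENNReal.ofReal ((borelTransform σ (t + δ * Complex.I)).re ^ 2) =
      ENNReal.ofReal (P t * (borelTransform σ (t + δ * Complex.I)).re ^ 2) := fun t =>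
    (ENNReal.ofReal_mul (hP0 t)).symm
  refine (lintegral_congr hmul).trans_le ?_
  rw [← ofReal_integral_eq_lintegral_ofReal hre
    (ae_of_all _ fun t => mul_nonneg (hP0 t) (sq_nonneg _)), hsum]
  refine ENNReal.ofReal_add_le.trans (add_le_add (ENNReal.ofReal_le_ofReal hmain) ?_)
  rw [ofReal_integral_eq_lintegral_ofReal him
    (ae_of_all _ fun t => mul_nonneg (hP0 t) (sq_nonneg _))]
  refine lintegral_mono fun t => ENNReal.ofReal_le_ofReal ?_
  exact mul_le_of_le_one_left (sq_nonneg _) (hP1 t)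

/-- The `L²` maximal theorem applied to the holomorphic function `sqrtLog ∘ w`. The constant is `8 ·
16² · 40 · 4`: comparison, Poisson domination, `L²` bound, comparison. -/
theorem lintegral_iSup_elog_borelTransform_le {δ : ℝ} (hδ : 0 < δ) :
    ∫⁻ x : ℝ, ⨆ (ε : ℝ) (_ : 0 < ε), elog (borelTransform σ (x + (δ + ε : ℝ) * Complex.I)) ≤
      327680 * ∫⁻ x : ℝ, elog (borelTransform σ (x + δ * Complex.I)) := by
  set F : ℂ → ℂ := fun z => sqrtLog (borelTransform σ z) with hF
  have hFd := differentiableOn_sqrtLog_borelTransform σ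
  have hFc : Continuous fun t : ℝ => F (t + δ * Complex.I) :=
    hFd.continuousOn.comp_continuous (by fun_prop) fun t => by simpa using hδ
  calc _ ≤ ∫⁻ x : ℝ, 2048 *
        maximalFunction (volume.withDensity fun t : ℝ => ‖F (t + δ * Complex.I)‖ₑ) x ^ 2 := by
        refine lintegral_mono fun x => iSup₂_le fun ε hε => ?_
        have h1 := enorm_le_maximalFunction hFd hδ
          (tendsto_comp_borelTransform σ (fun w hw => norm_sqrtLog_le hw) hδ) x hε
        have h2 := elog_le_sqrtLog (borelTransform_line_im_nonneg σ (add_pos hδ hε) x)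
        refine h2.trans ?_
        calc _ ≤ 8 * (16 * maximalFunction
              (volume.withDensity fun t : ℝ => ‖F (t + δ * Complex.I)‖ₑ) x) ^ 2 := by gcongr
          _ = _ := by rw [mul_pow, ← mul_assoc]; norm_num
    _ ≤ 2048 * (40 * ∫⁻ x : ℝ, ‖F (x + δ * Complex.I)‖ₑ ^ 2) := by
        rw [lintegral_const_mul' _ _ (by norm_num)]
        gcongr
        exact lintegral_maximalFunction_sq_le hFc.enorm.measurable
    _ ≤ 2048 * (40 * ∫⁻ x : ℝ, 4 * elog (borelTransform σ (x + δ * Complex.I))) := by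
        gcongr with x
        exact sqrtLog_le_elog (borelTransform_line_im_nonneg σ hδ x)
    _ = _ := by
        rw [lintegral_const_mul' _ _ (by norm_num), ← mul_assoc, ← mul_assoc]
        norm_num

end finite

/-! ### Vertical suprema and weak type bounds. -/

section maximal

variable (σ : Measure ℝ) [IsFiniteMeasure σ]

theorem measurable_iSup_elog_borelTransform {δ : ℝ} (hδ : 0 ≤ δ) :
    Measurable fun x : ℝ => ⨆ (ε : ℝ) (_ : 0 < ε),
      elog (borelTransform σ (x + (δ + ε : ℝ) * Complex.I)) := by
  refine LowerSemicontinuous.measurable ?_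
  exact lowerSemicontinuous_biSup fun ε hε => (continuous_elog.comp
    (continuous_borelTransform_line σ (add_pos_of_nonneg_of_pos hδ hε))).lowerSemicontinuous

theorem lintegral_iSup_elog_le_of_tendsto {b : ℕ → ℝ≥0∞} {B : ℝ≥0∞} (hb : Tendsto b atTop (𝓝 B))
    (h : ∀ n : ℕ, ∫⁻ x : ℝ, elog (borelTransform σ (x + (1 / (n + 1) : ℝ) * Complex.I)) ≤ b n) :
    ∫⁻ x : ℝ, ⨆ (ε : ℝ) (_ : 0 < ε), elog (borelTransform σ (x + ε * Complex.I)) ≤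
      327680 * B := by
  have hpos : ∀ n : ℕ, (0 : ℝ) < 1 / (n + 1) := fun n => by positivity
  calc _ ≤ ∫⁻ x : ℝ, liminf (fun n : ℕ => ⨆ (ε : ℝ) (_ : 0 < ε),
        elog (borelTransform σ (x + (1 / (n + 1) + ε : ℝ) * Complex.I))) atTop := by
        refine lintegral_mono fun x => iSup₂_le fun ε hε => ?_
        refine le_liminf_of_le (by isBoundedDefault) ?_
        -- Once `1/(n+1) < ε`, the height `ε` lies above the `n`-th base line and is seen by the
        -- `n`-th supremum.
        filter_upwards [tendsto_one_div_add_atTop_nhds_zero_nat.eventually (gt_mem_nhds hε)] with n hn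
        refine le_trans ?_ (le_iSup₂ (f := fun (ε : ℝ) (_ : 0 < ε) =>
          elog (borelTransform σ (x + (1 / (n + 1) + ε : ℝ) * Complex.I)))
          (ε - 1 / ((n : ℝ) + 1)) (sub_pos.2 hn))
        rw [add_sub_cancel]
    _ ≤ liminf (fun n : ℕ => ∫⁻ x : ℝ, ⨆ (ε : ℝ) (_ : 0 < ε),
        elog (borelTransform σ (x + (1 / (n + 1) + ε : ℝ) * Complex.I))) atTop :=
        lintegral_liminf_le fun n => measurable_iSup_elog_borelTransform σ (hpos n).le
    _ ≤ liminf (fun n : ℕ => 327680 * b n) atTop :=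
        liminf_le_liminf (Eventually.of_forall fun n =>
          (lintegral_iSup_elog_borelTransform_le σ (hpos n)).trans (mul_le_mul_right (h n) _))
    _ = 327680 * B := (ENNReal.Tendsto.const_mul hb (Or.inr (by norm_num))).liminf_eq

theorem lintegral_iSup_elog_le :
    ∫⁻ x : ℝ, ⨆ (ε : ℝ) (_ : 0 < ε), elog (borelTransform σ (x + ε * Complex.I)) ≤
      655360 * σ univ := by
  refine (lintegral_iSup_elog_le_of_tendsto σ tendsto_const_nhds fun n =>
    lintegral_elog_borelTransform_le σ (by positivity)).trans_eq ?_
  rw [← mul_assoc]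
  norm_num

theorem volume_exists_one_lt_borelTransform_le :
    volume {x : ℝ | ∃ ε : ℝ, 0 < ε ∧ 1 < ‖borelTransform σ (x + ε * Complex.I)‖} ≤
      1310720 * σ univ := by
  have hm := measurable_iSup_elog_borelTransform σ le_rfl
  simp only [zero_add] at hm
  have h1 := mul_meas_ge_le_lintegral (μ := volume) hm 2⁻¹
  have h2 : {x : ℝ | ∃ ε : ℝ, 0 < ε ∧ 1 < ‖borelTransform σ (x + ε * Complex.I)‖} ⊆
      {x : ℝ | 2⁻¹ ≤ ⨆ (ε : ℝ) (_ : 0 < ε), elog (borelTransform σ (x + ε * Complex.I))} := by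
    rintro x ⟨ε, hε, h⟩
    refine le_trans ?_ (le_iSup₂ (f := fun (ε : ℝ) (_ : 0 < ε) =>
      elog (borelTransform σ (x + ε * Complex.I))) ε hε)
    have h3 : Real.log 2 ≤ Real.log (1 + ‖borelTransform σ (x + ε * Complex.I)‖ ^ 2) :=
      Real.log_le_log (by norm_num) (by nlinarith)
    rw [show (2⁻¹ : ℝ≥0∞) = ENNReal.ofReal 2⁻¹ by
      rw [ENNReal.ofReal_inv_of_pos (by norm_num)]; norm_num]
    exact ENNReal.ofReal_le_ofReal (by linarith [Real.log_two_gt_d9])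
  calc _ ≤ 2 * (2⁻¹ * volume {x : ℝ | 2⁻¹ ≤ ⨆ (ε : ℝ) (_ : 0 < ε),
        elog (borelTransform σ (x + ε * Complex.I))}) := by
        rw [← mul_assoc, ENNReal.mul_inv_cancel (by norm_num) (by norm_num), one_mul]
        exact measure_mono h2
    _ ≤ 2 * (655360 * σ univ) := by
        exact mul_le_mul_right (h1.trans (lintegral_iSup_elog_le σ)) _
    _ = _ := by rw [← mul_assoc]; norm_num

/-- The weak type `(1, 1)` bound for the maximal Borel transform. -/
theorem volume_exists_lt_borelTransform_le {t : ℝ≥0} (ht : 0 < t) :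
    volume {x : ℝ | ∃ ε : ℝ, 0 < ε ∧ t < ‖borelTransform σ (x + ε * Complex.I)‖} ≤
      1310720 * (t⁻¹ : ℝ≥0) * σ univ := by
  -- Linearity in `σ` reduces the level `t` to the level 1.
  have h := volume_exists_one_lt_borelTransform_le (t⁻¹ • σ)
  rw [Measure.smul_apply, show t⁻¹ • σ univ = ((t⁻¹ : ℝ≥0) : ℝ≥0∞) * σ univ from rfl,
    ← mul_assoc] at h
  refine le_trans (measure_mono ?_) h
  rintro x ⟨ε, hε, hx⟩
  refine ⟨ε, hε, ?_⟩
  rw [borelTransform_smul, norm_mul, Complex.norm_of_nonneg (NNReal.coe_nonneg _), NNReal.coe_inv,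
    inv_mul_eq_div]
  exact (one_lt_div (by exact_mod_cast ht)).2 hx

end maximal

/-! ### Kernels at Lebesgue points. -/

section lebesgue

variable (σ : Measure ℝ)

/-- The measure `|f - c| dx + dσₛ` for the Lebesgue decomposition `dσ = f dx + dσₛ`. -/
noncomputable def oscMeasure (c : ℝ) : Measure ℝ :=
  σ.singularPart volume + volume.withDensity fun y => ‖(σ.rnDeriv volume y).toReal - c‖ₑ

variable [IsFiniteMeasure σ]

theorem ae_tendsto_oscMeasure :
    ∀ᵐ x, Tendsto (fun L : ℝ => oscMeasure σ (σ.rnDeriv volume x).toReal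
      (Icc (x - L) (x + L)) / ENNReal.ofReal (2 * L)) (𝓝[>] 0) (𝓝 0) := by
  have h1 := Besicovitch.ae_tendsto_rnDeriv (σ.singularPart volume) volume
  have h2 := Measure.rnDeriv_singularPart σ volume
  have h3 := (Besicovitch.vitaliFamily (volume : Measure ℝ)).ae_tendsto_lintegral_enorm_sub_div
    (Measure.integrable_toReal_rnDeriv (μ := σ) (ν := volume)).locallyIntegrable
  filter_upwards [h1, h2, h3] with x h1 h2 h3
  rw [h2] at h1
  have h4 := h1.add (h3.comp (Besicovitch.tendsto_filterAt volume x))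
  simp only [Pi.zero_apply, add_zero] at h4
  refine h4.congr fun L => ?_
  simp only [Function.comp, oscMeasure, Measure.add_apply]
  rw [withDensity_apply _ measurableSet_Icc, ENNReal.add_div, Real.volume_closedBall,
    Real.closedBall_eq_Icc]

theorem singularPart_add_withDensity_toReal :
    σ = σ.singularPart volume +
      volume.withDensity fun y => ENNReal.ofReal (σ.rnDeriv volume y).toReal := by
  conv_lhs => rw [Measure.haveLebesgueDecomposition_add σ volume]
  congr 1
  refine withDensity_congr_ae ?_
  filter_upwards [Measure.rnDeriv_lt_top σ volume] with y hy
  rw [ENNReal.ofReal_toReal hy.ne]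

theorem maximalFunction_oscMeasure_le {c : ℝ} (hc : 0 ≤ c) (x : ℝ) :
    maximalFunction (oscMeasure σ c) x ≤ maximalFunction σ x + ENNReal.ofReal c := by
  refine iSup₂_le fun L hL => ?_
  have h2L : ENNReal.ofReal (2 * L) ≠ 0 := by simp [hL]
  rw [ENNReal.div_le_iff h2L ENNReal.ofReal_ne_top, add_mul]
  have hm : Measurable fun y => ENNReal.ofReal (σ.rnDeriv volume y).toReal :=
    (Measure.measurable_rnDeriv σ volume).ennreal_toReal.ennreal_ofReal
  calc oscMeasure σ c (Icc (x - L) (x + L))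
      ≤ σ.singularPart volume (Icc (x - L) (x + L)) + ∫⁻ y in Icc (x - L) (x + L),
          (ENNReal.ofReal (σ.rnDeriv volume y).toReal + ENNReal.ofReal c) := by
        rw [oscMeasure, Measure.add_apply, withDensity_apply _ measurableSet_Icc]
        gcongr with y
        refine (enorm_sub_le).trans_eq ?_
        rw [Real.enorm_of_nonneg ENNReal.toReal_nonneg, Real.enorm_of_nonneg hc]
    _ = σ (Icc (x - L) (x + L)) + ENNReal.ofReal c * ENNReal.ofReal (2 * L) := by
        rw [lintegral_add_left hm, setLIntegral_const, Real.volume_Icc,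
          show x + L - (x - L) = 2 * L by ring, ← add_assoc]
        conv_rhs => rw [singularPart_add_withDensity_toReal σ]
        rw [Measure.add_apply, withDensity_apply _ measurableSet_Icc]
    _ ≤ _ := by
        gcongr
        exact measure_Icc_le_of_maximalFunction_le le_rfl hL

/-- Dominated convergence over the dyadic scales: each average tends to 0, and all are bounded by
the finite maximal function against a summable weight. -/
theorem tendsto_lintegral_poisson {ν : Measure ℝ} {x : ℝ} (hM : maximalFunction ν x ≠ ⊤)
    (h : Tendsto (fun L : ℝ => ν (Icc (x - L) (x + L)) / ENNReal.ofReal (2 * L))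
      (𝓝[>] 0) (𝓝 0)) :
    Tendsto (fun ε : ℝ => ∫⁻ y, ENNReal.ofReal (ε / ((y - x) ^ 2 + ε ^ 2)) ∂ν)
      (𝓝[>] 0) (𝓝 0) := by
  have key : Tendsto (fun ε : ℝ => ∑' k : ℕ, 8 * (2⁻¹ : ℝ≥0∞) ^ k *
      (ν (Icc (x - 2 ^ k * ε) (x + 2 ^ k * ε)) / ENNReal.ofReal (2 * (2 ^ k * ε))))
      (𝓝[>] 0) (𝓝 0) := by
    simp_rw [← lintegral_count]
    have hz : (0 : ℝ≥0∞) = ∫⁻ _ : ℕ, 0 ∂Measure.count := by simp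
    rw [hz]
    refine tendsto_lintegral_filter_of_dominated_convergence
      (fun k => 8 * (2⁻¹ : ℝ≥0∞) ^ k * maximalFunction ν x)
      (Eventually.of_forall fun _ => measurable_of_countable _) ?_ ?_ ?_
    · filter_upwards [self_mem_nhdsWithin] with ε hε
      have hε' : 0 < ε := hε
      exact ae_of_all _ fun k =>
        mul_le_mul_right (measure_Icc_le_maximalFunction ν x (by positivity)) _
    · rw [lintegral_count, ENNReal.tsum_mul_right, tsum_eight_mul_half_pow]
      exact ENNReal.mul_ne_top (by norm_num) hM
    · refine ae_of_all _ fun k => ?_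
      have h1 : Tendsto (fun ε : ℝ => 2 ^ k * ε) (𝓝[>] 0) (𝓝[>] 0) := by
        refine tendsto_nhdsWithin_iff.2 ⟨?_, ?_⟩
        · have : Continuous fun ε : ℝ => 2 ^ k * ε := by fun_prop
          simpa using (this.tendsto 0).mono_left (nhdsWithin_le_nhds (s := Ioi 0))
        · filter_upwards [self_mem_nhdsWithin] with ε hε
          have hε' : 0 < ε := hε
          exact mem_Ioi.2 (by positivity)
      have hne : 8 * (2⁻¹ : ℝ≥0∞) ^ k ≠ ⊤ :=
        ENNReal.mul_ne_top (by norm_num) (ENNReal.pow_ne_top (by norm_num))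
      simpa using ENNReal.Tendsto.const_mul (h.comp h1) (Or.inr hne)
  refine tendsto_of_tendsto_of_tendsto_of_le_of_le' tendsto_const_nhds key
    (Eventually.of_forall fun _ => zero_le) ?_
  filter_upwards [self_mem_nhdsWithin] with ε hε
  exact lintegral_poisson_le_tsum ν x hε

theorem ae_tendsto_lintegral_poisson_oscMeasure :
    ∀ᵐ x, Tendsto (fun ε : ℝ => ∫⁻ y, ENNReal.ofReal (ε / ((y - x) ^ 2 + ε ^ 2))
      ∂(oscMeasure σ (σ.rnDeriv volume x).toReal)) (𝓝[>] 0) (𝓝 0) := by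
  filter_upwards [ae_tendsto_oscMeasure σ, ae_maximalFunction_lt_top σ] with x h1 h2
  refine tendsto_lintegral_poisson ?_ h1
  exact ne_top_of_le_ne_top (ENNReal.add_ne_top.2 ⟨h2.ne, ENNReal.ofReal_ne_top⟩)
    (maximalFunction_oscMeasure_le σ ENNReal.toReal_nonneg x)

/-- With `dσ = f dx + dσₛ`, the left side is `∫ k dσₛ + ∫ (f - c) k`. It serves both the Poisson
kernel, for the imaginary part, and the odd error kernel that compares the real part with the
truncated transform. -/
theorem enorm_integral_sub_le {k : ℝ → ℝ} (hk : Measurable k) (c x : ℝ) {ε : ℝ} (hε : 0 < ε)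
    (hkε : ∀ y, |k y| ≤ ε / ((y - x) ^ 2 + ε ^ 2)) :
    ‖∫ y, k y ∂σ - c * ∫ y, k y‖ₑ ≤
      ∫⁻ y, ENNReal.ofReal (ε / ((y - x) ^ 2 + ε ^ 2)) ∂(oscMeasure σ c) := by
  set f : ℝ → ℝ := fun y => (σ.rnDeriv volume y).toReal with hf
  have hfm : Measurable f := (Measure.measurable_rnDeriv σ volume).ennreal_toReal
  have hfint : Integrable f := Measure.integrable_toReal_rnDeriv
  have hbd : ∀ y, ‖k y‖ ≤ ε⁻¹ := fun y => (hkε y).trans (by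
    rw [div_le_iff₀ (by positivity), inv_mul_eq_div, le_div_iff₀ hε]
    nlinarith [sq_nonneg (y - x)])
  have hkvol : Integrable k :=
    (integrable_poisson x hε).mono' hk.aestronglyMeasurable (ae_of_all _ hkε)
  have hks : Integrable k (σ.singularPart volume) :=
    Integrable.of_bound hk.aestronglyMeasurable _ (ae_of_all _ hbd)
  have hfk : Integrable fun y => f y * k y :=
    hfint.mul_bdd hk.aestronglyMeasurable (ae_of_all _ hbd)
  have hac : IsFiniteMeasure (volume.withDensity fun y => ENNReal.ofReal (f y)) := by
    refine isFiniteMeasure_of_le σ ?_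
    conv_rhs => rw [singularPart_add_withDensity_toReal σ]
    exact Measure.le_add_left le_rfl
  have hdec : ∫ y, k y ∂σ - c * ∫ y, k y =
      ∫ y, k y ∂(σ.singularPart volume) + ∫ y, (f y - c) * k y := by
    conv_lhs => rw [singularPart_add_withDensity_toReal σ]
    rw [integral_add_measure hks (Integrable.of_bound hk.aestronglyMeasurable _ (ae_of_all _ hbd)),
      integral_withDensity_eq_integral_toReal_smul (hfm.ennreal_ofReal)
        (ae_of_all _ fun _ => ENNReal.ofReal_lt_top)]
    have h1 : ∀ y, (ENNReal.ofReal (f y)).toReal • k y = f y * k y := fun y => by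
      rw [ENNReal.toReal_ofReal ENNReal.toReal_nonneg, smul_eq_mul]
    simp_rw [sub_mul]
    rw [integral_sub hfk (hkvol.const_mul c), integral_const_mul]
    simp_rw [h1]
    ring
  have hpm : Measurable fun y : ℝ => ENNReal.ofReal (ε / ((y - x) ^ 2 + ε ^ 2)) := by fun_prop
  have hke : ∀ y, ‖k y‖ₑ ≤ ENNReal.ofReal (ε / ((y - x) ^ 2 + ε ^ 2)) := fun y => by
    rw [← ofReal_norm]
    exact ENNReal.ofReal_le_ofReal (hkε y)
  rw [hdec, oscMeasure, lintegral_add_measure,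
    lintegral_withDensity_eq_lintegral_mul _ ((hfm.sub_const c).enorm) hpm]
  refine (enorm_add_le _ _).trans (add_le_add ?_ ?_)
  · exact (enorm_integral_le_lintegral_enorm _).trans (lintegral_mono hke)
  · refine (enorm_integral_le_lintegral_enorm _).trans (lintegral_mono fun y => ?_)
    rw [enorm_mul]
    exact mul_le_mul_right (hke y) _

theorem ae_tendsto_borelTransform_im :
    ∀ᵐ x : ℝ, Tendsto (fun ε : ℝ => (borelTransform σ (x + ε * Complex.I)).im) (𝓝[>] 0)
      (𝓝 (σ.rnDeriv volume x).toReal) := by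
  filter_upwards [ae_tendsto_lintegral_poisson_oscMeasure σ] with x hx
  set c := (σ.rnDeriv volume x).toReal
  have h1 : Tendsto (fun ε : ℝ => ∫ y, ε / ((y - x) ^ 2 + ε ^ 2) ∂σ - c * Real.pi) (𝓝[>] 0)
      (𝓝 0) := by
    rw [tendsto_iff_enorm_sub_tendsto_zero]
    refine tendsto_of_tendsto_of_tendsto_of_le_of_le' tendsto_const_nhds hx
      (Eventually.of_forall fun _ => zero_le) ?_
    filter_upwards [self_mem_nhdsWithin] with ε hε
    have hε' : 0 < ε := hε
    rw [sub_zero, ← integral_poisson x hε]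
    refine enorm_integral_sub_le σ (by fun_prop) c x hε fun y => ?_
    rw [abs_of_nonneg (by positivity)]
  have h2 := (h1.add_const (c * Real.pi)).const_mul Real.pi⁻¹
  simp only [sub_add_cancel, zero_add] at h2
  rw [mul_comm c, inv_mul_cancel_left₀ Real.pi_pos.ne'] at h2
  refine h2.congr' ?_
  filter_upwards [self_mem_nhdsWithin] with ε hε
  rw [borelTransform_im σ x hε]

/-- For `|t| > ε` the difference is exactly `-(ε/t)` times the Poisson kernel; for `|t| ≤ ε` the
truncated kernel is absent and `|t| ≤ ε` suffices. -/
theorem abs_conjPoisson_sub_le (t : ℝ) {ε : ℝ} (hε : 0 < ε) :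
    |t / (t ^ 2 + ε ^ 2) - (if ε < |t| then 1 / t else 0)| ≤ ε / (t ^ 2 + ε ^ 2) := by
  have hpos : 0 < t ^ 2 + ε ^ 2 := by positivity
  split_ifs with h
  · have ht : t ≠ 0 := by rintro rfl; simp at h; linarith
    have h1 : t / (t ^ 2 + ε ^ 2) - 1 / t = -(ε / t) * (ε / (t ^ 2 + ε ^ 2)) := by
      field_simp
      ring
    rw [h1, abs_mul, abs_neg, abs_div, abs_of_pos hε, abs_of_pos (by positivity : 0 < ε / (t ^ 2 + ε ^ 2))]
    refine mul_le_of_le_one_left (by positivity) ?_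
    rw [div_le_one (by positivity)]
    exact h.le
  · rw [sub_zero, abs_div, abs_of_pos hpos]
    gcongr
    exact not_lt.1 h

theorem ae_tendsto_borelTransform_re_add_truncHilbert :
    ∀ᵐ x : ℝ, Tendsto (fun ε : ℝ => (borelTransform σ (x + ε * Complex.I)).re +
      truncHilbert σ ε x) (𝓝[>] 0) (𝓝 0) := by
  filter_upwards [ae_tendsto_lintegral_poisson_oscMeasure σ] with x hx
  set g : ℝ → ℝ → ℝ := fun ε t => t / (t ^ 2 + ε ^ 2) - (if ε < |t| then 1 / t else 0) with hg
  have hgm : ∀ ε, Measurable (g ε) := fun ε =>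
    Measurable.sub (by fun_prop) (Measurable.ite
      (measurableSet_lt measurable_const (by fun_prop)) (by fun_prop) measurable_const)
  -- Oddness removes the contribution of the constant density `c`, leaving only the oscillation.
  have hodd : ∀ ε, ∫ y, g ε (y - x) = 0 := fun ε => by
    rw [integral_sub_right_eq_self (g ε) x]
    have h1 : ∀ t, g ε (-t) = -g ε t := fun t => by
      simp only [hg, abs_neg, neg_sq]
      split_ifs
      · rw [one_div, one_div, inv_neg]; ring
      · ring
    have h2 := integral_neg_eq_self (g ε) volume
    simp_rw [h1, integral_neg] at h2
    linarith
  have h1 : Tendsto (fun ε : ℝ => ∫ y, g ε (y - x) ∂σ) (𝓝[>] 0) (𝓝 0) := by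
    rw [tendsto_iff_enorm_sub_tendsto_zero]
    refine tendsto_of_tendsto_of_tendsto_of_le_of_le' tendsto_const_nhds hx
      (Eventually.of_forall fun _ => zero_le) ?_
    filter_upwards [self_mem_nhdsWithin] with ε hε
    have h := enorm_integral_sub_le σ (k := fun y => g ε (y - x))
      ((hgm ε).comp (by fun_prop)) (σ.rnDeriv volume x).toReal x hε
      fun y => abs_conjPoisson_sub_le (y - x) hε
    rwa [hodd, mul_zero] at h
  have h2 := h1.const_mul Real.pi⁻¹
  rw [mul_zero] at h2
  refine h2.congr' ?_
  filter_upwards [self_mem_nhdsWithin] with ε hε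
  have hε' : 0 < ε := hε
  rw [borelTransform_re σ x hε, truncHilbert, one_div, ← mul_add]
  congr 1
  have hms : MeasurableSet {y : ℝ | ε < |x - y|} :=
    measurableSet_lt measurable_const (by fun_prop)
  rw [← integral_indicator hms, ← integral_add (integrable_conjPoisson σ x hε)]
  · refine integral_congr_ae (ae_of_all _ fun y => ?_)
    simp only [hg, indicator_apply, mem_ofPred_eq, abs_sub_comm x y]
    split_ifs
    · rw [← neg_sub y x, one_div, one_div, inv_neg]; ring
    · ring
  · refine Integrable.of_bound (Measurable.indicator (by fun_prop) hms).aestronglyMeasurable ε⁻¹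
      (ae_of_all _ fun y => ?_)
    rw [indicator_apply]
    split_ifs with h
    · rw [one_div, norm_inv]
      exact inv_anti₀ hε (le_of_lt h)
    · simp [hε'.le]

end lebesgue

/-! ### Almost everywhere existence of vertical limits. -/

/-- The real part of the Borel transform of `σ` has a vertical limit at `x`. -/
def HasVerticalLimit (σ : Measure ℝ) (x : ℝ) : Prop :=
  ∃ l : ℝ, Tendsto (fun ε : ℝ => (borelTransform σ (x + ε * Complex.I)).re) (𝓝[>] 0) (𝓝 l)

theorem HasVerticalLimit.add {σ τ : Measure ℝ} [IsFiniteMeasure σ] [IsFiniteMeasure τ] {x : ℝ}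
    (hσ : HasVerticalLimit σ x) (hτ : HasVerticalLimit τ x) : HasVerticalLimit (σ + τ) x := by
  obtain ⟨a, ha⟩ := hσ
  obtain ⟨b, hb⟩ := hτ
  refine ⟨a + b, (ha.add hb).congr' ?_⟩
  filter_upwards [self_mem_nhdsWithin] with ε hε
  rw [borelTransform_add τ (by simpa using hε), Complex.add_re]

theorem hasVerticalLimit_restrict_of_notMem (σ : Measure ℝ) [IsFiniteMeasure σ] {K : Set ℝ}
    (hK : IsClosed K) {x : ℝ} (hx : x ∉ K) : HasVerticalLimit (σ.restrict K) x := by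
  rcases K.eq_empty_or_nonempty with rfl | hne
  · refine ⟨0, tendsto_const_nhds.congr' (Eventually.of_forall fun ε => ?_)⟩
    simp [borelTransform]
  have hd : 0 < Metric.infDist x K := (hK.notMem_iff_infDist_pos hne).1 hx
  set d := Metric.infDist x K
  have hdist : ∀ᵐ y ∂(σ.restrict K), d ≤ |y - x| := by
    filter_upwards [ae_restrict_mem hK.measurableSet] with y hy
    rw [abs_sub_comm]
    exact Metric.infDist_le_dist_of_mem hy
  have h : Tendsto (fun ε : ℝ => ∫ y, (y - x) / ((y - x) ^ 2 + ε ^ 2) ∂(σ.restrict K)) (𝓝[>] 0)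
      (𝓝 (∫ y, (y - x) / ((y - x) ^ 2 + 0 ^ 2) ∂(σ.restrict K))) := by
    refine tendsto_integral_filter_of_dominated_convergence (fun _ => d⁻¹)
      (Eventually.of_forall fun ε => Measurable.aestronglyMeasurable (by fun_prop)) ?_
      (integrable_const _) ?_
    · refine Eventually.of_forall fun ε => ?_
      filter_upwards [hdist] with y hy
      have h1 : 0 < |y - x| := hd.trans_le hy
      have h2 : 0 < (y - x) ^ 2 := by rw [← sq_abs]; positivity
      rw [Real.norm_eq_abs, abs_div, abs_of_pos (show 0 < (y - x) ^ 2 + ε ^ 2 by positivity)]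
      rw [div_le_iff₀ (by positivity), inv_mul_eq_div, le_div_iff₀ hd]
      have h3 : (y - x) ^ 2 = |y - x| * |y - x| := by rw [← sq_abs, sq]
      nlinarith [sq_nonneg ε]
    · filter_upwards [hdist] with y hy
      have h1 : 0 < |y - x| := hd.trans_le hy
      have h2 : 0 < (y - x) ^ 2 := by rw [← sq_abs]; positivity
      have hc : ContinuousAt (fun ε : ℝ => (y - x) / ((y - x) ^ 2 + ε ^ 2)) 0 :=
        ContinuousAt.div continuousAt_const (by fun_prop) (by positivity)
      exact hc.tendsto.mono_left nhdsWithin_le_nhds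
  refine ⟨_, (h.const_mul Real.pi⁻¹).congr' ?_⟩
  filter_upwards [self_mem_nhdsWithin] with ε hε
  rw [borelTransform_re _ x hε]

/-- The kernel is odd, so only the odd part of `g` about `x` matters. For Lipschitz `g` that part is
`O(|t|)` and cancels the singularity uniformly in `ε`. -/
theorem integral_conjPoisson_mul_eq {g : ℝ → ℝ} (hg : Integrable g) (x : ℝ) {ε : ℝ} (hε : 0 < ε) :
    ∫ y, (y - x) / ((y - x) ^ 2 + ε ^ 2) * g y =
      ∫ t, t / (t ^ 2 + ε ^ 2) * ((g (t + x) - g (-t + x)) / 2) := by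
  have hbd : ∀ t : ℝ, ‖t / (t ^ 2 + ε ^ 2)‖ ≤ ε⁻¹ := fun t => by
    rw [Real.norm_eq_abs, abs_div, abs_of_pos (show 0 < t ^ 2 + ε ^ 2 by positivity),
      div_le_iff₀ (by positivity), inv_mul_eq_div, le_div_iff₀ hε]
    nlinarith [sq_nonneg (|t| - ε), sq_abs t, sq_nonneg t]
  have hint : Integrable fun t => t / (t ^ 2 + ε ^ 2) * g (t + x) :=
    (hg.comp_add_right x).bdd_mul (Measurable.aestronglyMeasurable (by fun_prop))
      (ae_of_all _ hbd)
  have h1 : ∫ y, (y - x) / ((y - x) ^ 2 + ε ^ 2) * g y =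
      ∫ t, t / (t ^ 2 + ε ^ 2) * g (t + x) := by
    rw [← integral_add_right_eq_self (fun y => (y - x) / ((y - x) ^ 2 + ε ^ 2) * g y) x]
    simp
  have h2 : ∫ t, t / (t ^ 2 + ε ^ 2) * g (t + x) =
      ∫ t, -(t / (t ^ 2 + ε ^ 2) * g (-t + x)) := by
    rw [← integral_neg_eq_self]
    refine integral_congr_ae (ae_of_all _ fun t => ?_)
    simp only [neg_sq]
    ring
  have hint2 : Integrable fun t => -(t / (t ^ 2 + ε ^ 2) * g (-t + x)) := by
    refine hint.comp_neg.congr (ae_of_all _ fun t => ?_)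
    simp only [neg_sq]
    ring
  have h3 : ∫ t, t / (t ^ 2 + ε ^ 2) * ((g (t + x) - g (-t + x)) / 2) =
      (1 / 2) * (∫ t, t / (t ^ 2 + ε ^ 2) * g (t + x)) +
      (1 / 2) * ∫ t, -(t / (t ^ 2 + ε ^ 2) * g (-t + x)) := by
    rw [← integral_const_mul, ← integral_const_mul,
      ← integral_add (hint.const_mul _) (hint2.const_mul _)]
    refine integral_congr_ae (ae_of_all _ fun t => ?_)
    simp only
    ring
  rw [h3, ← h2, h1]
  ring

theorem hasVerticalLimit_withDensity {g : ℝ → ℝ} (hg0 : ∀ y, 0 ≤ g y) {L : ℝ≥0}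
    (hL : LipschitzWith L g) (hc : HasCompactSupport g) (x : ℝ) :
    HasVerticalLimit (volume.withDensity fun y => ENNReal.ofReal (g y)) x := by
  have hint : Integrable g := hL.continuous.integrable_of_hasCompactSupport hc
  have hfin : IsFiniteMeasure (volume.withDensity fun y => ENNReal.ofReal (g y)) :=
    isFiniteMeasure_withDensity_ofReal hint.2
  obtain ⟨R, hR⟩ : ∃ R : ℝ, ∀ y, R < |y| → g y = 0 := by
    obtain ⟨R, hR⟩ := hc.isBounded.exists_norm_le
    refine ⟨R, fun y hy => ?_⟩
    by_contra h
    exact absurd (hR y (subset_tsupport g h)) (not_le.2 hy)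
  have h : Tendsto (fun ε : ℝ => ∫ t, t / (t ^ 2 + ε ^ 2) * ((g (t + x) - g (-t + x)) / 2)) (𝓝[>] 0)
      (𝓝 (∫ t, t / (t ^ 2 + 0 ^ 2) * ((g (t + x) - g (-t + x)) / 2))) := by
    refine tendsto_integral_filter_of_dominated_convergence
      ((Icc (-(R + |x|)) (R + |x|)).indicator fun _ => (L : ℝ))
      (Eventually.of_forall fun ε => Measurable.aestronglyMeasurable ?_) ?_
      ((integrableOn_const (by simp)).integrable_indicator measurableSet_Icc) ?_
    · have := hL.continuous.measurable
      fun_prop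
    · refine Eventually.of_forall fun ε => ae_of_all _ fun t => ?_
      by_cases ht : t ∈ Icc (-(R + |x|)) (R + |x|)
      · rw [indicator_of_mem ht, norm_mul, norm_div, norm_div]
        have h1 : ‖g (t + x) - g (-t + x)‖ ≤ L * (2 * |t|) := by
          have := hL.dist_le_mul (t + x) (-t + x)
          rw [dist_eq_norm, Real.dist_eq, show t + x - (-t + x) = 2 * t by ring, abs_mul] at this
          simpa using this
        have h2 : ‖t ^ 2 + ε ^ 2‖ = t ^ 2 + ε ^ 2 := Real.norm_of_nonneg (by positivity)
        rw [h2, Real.norm_eq_abs t, Real.norm_ofNat]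
        calc |t| / (t ^ 2 + ε ^ 2) * (‖g (t + x) - g (-t + x)‖ / 2)
            ≤ |t| / (t ^ 2 + ε ^ 2) * (L * (2 * |t|) / 2) := by gcongr
          _ = L * (t ^ 2 / (t ^ 2 + ε ^ 2)) := by rw [← sq_abs t]; ring
          _ ≤ L * 1 := by
              gcongr
              exact div_le_one_of_le₀ (by nlinarith) (by positivity)
          _ = L := mul_one _
      · have h1 : R + |x| < |t| := by
          by_contra h
          exact ht (abs_le.1 (not_lt.1 h))
        have h2 : g (t + x) = 0 := hR _ (by
          have := abs_sub_abs_le_abs_sub t (-x)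
          rw [abs_neg, sub_neg_eq_add] at this
          linarith)
        have h3 : g (-t + x) = 0 := hR _ (by
          have := abs_sub_abs_le_abs_sub (-t) (-x)
          rw [abs_neg, abs_neg, sub_neg_eq_add] at this
          linarith)
        rw [indicator_of_notMem ht, h2, h3]
        simp
    · refine ae_of_all _ fun t => ?_
      rcases eq_or_ne t 0 with rfl | ht
      · simp
      · have hc : ContinuousAt (fun ε : ℝ => t / (t ^ 2 + ε ^ 2) *
            ((g (t + x) - g (-t + x)) / 2)) 0 :=
          (ContinuousAt.div continuousAt_const (by fun_prop) (by positivity)).mul_const _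
        exact hc.tendsto.mono_left nhdsWithin_le_nhds
  refine ⟨_, (h.const_mul Real.pi⁻¹).congr' ?_⟩
  filter_upwards [self_mem_nhdsWithin] with ε hε
  rw [borelTransform_re _ x hε, ← integral_conjPoisson_mul_eq hint x hε,
    integral_withDensity_eq_integral_toReal_smul hL.continuous.measurable.ennreal_ofReal
      (ae_of_all _ fun _ => ENNReal.ofReal_lt_top)]
  congr 1
  refine integral_congr_ae (ae_of_all _ fun y => ?_)
  simp only [ENNReal.toReal_ofReal (hg0 y), smul_eq_mul]
  ring

/-- The decomposition `σ = μ + τ - τ'` is written additively to stay among positive measures. `μ`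
consists of a Lipschitz density near `f` in `L¹` and the singular part on a compact null set `K`;
`τ` and `τ'` collect the positive and negative density errors, with the remaining singular mass in
`τ`. -/
theorem exists_vertical_limit_approx (σ : Measure ℝ) [IsFiniteMeasure σ] {η : ℝ} (hη : 0 < η) :
    ∃ μ τ τ' : Measure ℝ, IsFiniteMeasure μ ∧ IsFiniteMeasure τ ∧ IsFiniteMeasure τ' ∧
      σ + τ' = μ + τ ∧ τ univ ≤ 2 * ENNReal.ofReal η ∧ τ' univ ≤ 2 * ENNReal.ofReal η ∧
      ∀ᵐ x, HasVerticalLimit μ x := by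
  obtain ⟨s, hs, hs0, hs1⟩ := Measure.mutuallySingular_singularPart σ volume
  set ρ := σ.singularPart volume with hρ
  obtain ⟨K, hKs, hK, hKη⟩ := hs.compl.exists_isCompact_sdiff_lt (μ := ρ) (measure_ne_top _ _)
    (ENNReal.ofReal_pos.2 hη).ne'
  set f : ℝ → ℝ := fun y => (σ.rnDeriv volume y).toReal with hf
  have hfm : Measurable f := (Measure.measurable_rnDeriv σ volume).ennreal_toReal
  have hf0 : ∀ y, 0 ≤ f y := fun y => ENNReal.toReal_nonneg
  have hfint : Integrable f := Measure.integrable_toReal_rnDeriv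
  obtain ⟨h, hhc, hhs, hhf⟩ := (memLp_one_iff_integrable.2 hfint).exist_eLpNorm_sub_le
    (by norm_num) le_rfl hη
  rw [eLpNorm_one_eq_lintegral_enorm] at hhf
  -- Truncating at 0 keeps the Lipschitz bound and, since `f ≥ 0`, does not worsen the
  -- approximation.
  set g : ℝ → ℝ := fun y => max (h y) 0 with hg
  have hg0 : ∀ y, 0 ≤ g y := fun y => le_max_right _ _
  obtain ⟨L, hL⟩ := (hhs.of_le (by simp) : ContDiff ℝ 1 h).lipschitzWith_of_hasCompactSupport hhc
    one_ne_zero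
  have hgL : LipschitzWith L g := hL.max_const 0
  have hgc : HasCompactSupport g := hhc.comp_left (g := fun a : ℝ => max a 0) (by simp)
  have hgint : Integrable g := hgL.continuous.integrable_of_hasCompactSupport hgc
  have hgm : Measurable g := hgL.continuous.measurable
  have i1 : IsFiniteMeasure (volume.withDensity fun y => ENNReal.ofReal (g y)) :=
    isFiniteMeasure_withDensity_ofReal hgint.2
  have i2 : IsFiniteMeasure (volume.withDensity fun y => ENNReal.ofReal (f y - g y)) :=
    isFiniteMeasure_withDensity_ofReal (hfint.sub hgint).2
  have i3 : IsFiniteMeasure (volume.withDensity fun y => ENNReal.ofReal (g y - f y)) :=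
    isFiniteMeasure_withDensity_ofReal (hgint.sub hfint).2
  have hfg : ∫⁻ y, ENNReal.ofReal (f y - g y) ≤ ENNReal.ofReal η := by
    refine (lintegral_mono fun y => ?_).trans hhf
    rw [Pi.sub_apply, ← ofReal_norm]
    refine ENNReal.ofReal_le_ofReal (le_trans ?_ (le_abs_self _))
    linarith [le_max_left (h y) 0]
  have hgf : ∫⁻ y, ENNReal.ofReal (g y - f y) ≤ ENNReal.ofReal η := by
    refine (lintegral_mono fun y => ?_).trans hhf
    rw [Pi.sub_apply, ← ofReal_norm]
    refine ENNReal.ofReal_le_ofReal ?_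
    rw [Real.norm_eq_abs, abs_sub_comm]
    rcases le_total (h y) 0 with h1 | h1
    · simp only [hg, max_eq_right h1]
      linarith [hf0 y, abs_nonneg (h y - f y)]
    · simp only [hg, max_eq_left h1]
      exact le_abs_self _
  refine ⟨volume.withDensity (fun y => ENNReal.ofReal (g y)) + ρ.restrict K,
    volume.withDensity (fun y => ENNReal.ofReal (f y - g y)) + ρ.restrict Kᶜ,
    volume.withDensity fun y => ENNReal.ofReal (g y - f y), inferInstance, inferInstance,
    inferInstance, ?_, ?_, ?_, ?_⟩
  · have h1 : volume.withDensity (fun y => ENNReal.ofReal (f y)) +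
        volume.withDensity (fun y => ENNReal.ofReal (g y - f y)) =
        volume.withDensity (fun y => ENNReal.ofReal (g y)) +
        volume.withDensity fun y => ENNReal.ofReal (f y - g y) := by
      rw [← withDensity_add_left hfm.ennreal_ofReal, ← withDensity_add_left hgm.ennreal_ofReal]
      congr 1
      ext y
      rw [Pi.add_apply, Pi.add_apply]
      rcases le_total (f y) (g y) with h2 | h2
      · rw [ENNReal.ofReal_of_nonpos (sub_nonpos.2 h2), add_zero,
          ← ENNReal.ofReal_add (hf0 y) (sub_nonneg.2 h2)]
        congr 1; ring
      · rw [ENNReal.ofReal_of_nonpos (sub_nonpos.2 h2), add_zero,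
          ← ENNReal.ofReal_add (hg0 y) (sub_nonneg.2 h2)]
        congr 1; ring
    conv_lhs => rw [singularPart_add_withDensity_toReal σ]
    rw [← hρ, add_assoc, h1]
    conv_lhs => rw [← Measure.restrict_add_restrict_compl (μ := ρ) hK.isClosed.measurableSet]
    abel
  · rw [Measure.add_apply, withDensity_apply _ MeasurableSet.univ, Measure.restrict_univ,
      Measure.restrict_apply MeasurableSet.univ, univ_inter, two_mul]
    refine add_le_add hfg ?_
    calc ρ Kᶜ ≤ ρ (s ∪ (sᶜ \ K)) := measure_mono fun y hy => by
          by_cases hys : y ∈ s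
          · exact Or.inl hys
          · exact Or.inr ⟨hys, hy⟩
      _ ≤ ρ s + ρ (sᶜ \ K) := measure_union_le _ _
      _ ≤ ENNReal.ofReal η := by rw [hs0, zero_add]; exact hKη.le
  · rw [withDensity_apply _ MeasurableSet.univ, Measure.restrict_univ]
    exact hgf.trans (le_mul_of_one_le_left' (by norm_num))
  · have hK0 : volume K = 0 := measure_mono_null hKs hs1
    filter_upwards [measure_eq_zero_iff_ae_notMem.1 hK0] with x hx
    exact (hasVerticalLimit_withDensity hg0 hgL hgc x).add
      (hasVerticalLimit_restrict_of_notMem ρ hK.isClosed hx)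

/-- Off the exceptional sets, the oscillation is at most `t` from `μ` and `2t` from each of `τ`,
`τ'`, hence the 5. The exceptional sets have measure `O(η/t)` by the weak type bound, and `η` is
arbitrary. -/
theorem volume_oscillation_eq_zero (σ : Measure ℝ) [IsFiniteMeasure σ] {t : ℝ≥0} (ht : 0 < t) :
    volume {x : ℝ | ¬ ∃ δ : ℝ, 0 < δ ∧ ∀ ε ∈ Ioo 0 δ, ∀ ε' ∈ Ioo 0 δ,
      |(borelTransform σ (x + ε * Complex.I)).re - (borelTransform σ (x + ε' * Complex.I)).re| ≤
        5 * t} = 0 := by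
  set B := {x : ℝ | ¬ ∃ δ : ℝ, 0 < δ ∧ ∀ ε ∈ Ioo 0 δ, ∀ ε' ∈ Ioo 0 δ,
      |(borelTransform σ (x + ε * Complex.I)).re - (borelTransform σ (x + ε' * Complex.I)).re| ≤
        5 * t} with hB
  have key : ∀ η : ℝ, 0 < η → volume B ≤ 5242880 * (t⁻¹ : ℝ≥0) * ENNReal.ofReal η := by
    intro η hη
    obtain ⟨μ, τ, τ', i1, i2, i3, heq, hτ, hτ', hlim⟩ := exists_vertical_limit_approx σ hη
    have hsub : B ⊆ {x | ¬ HasVerticalLimit μ x} ∪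
        ({x : ℝ | ∃ ε : ℝ, 0 < ε ∧ t < ‖borelTransform τ (x + ε * Complex.I)‖} ∪
        {x : ℝ | ∃ ε : ℝ, 0 < ε ∧ t < ‖borelTransform τ' (x + ε * Complex.I)‖}) := by
      intro x hx
      by_contra hcon
      simp only [mem_union, mem_ofPred_eq, not_or, not_not, not_exists, not_and, not_lt] at hcon
      obtain ⟨⟨l, hl⟩, h1, h2⟩ := hcon
      apply hx
      have ht' : (0 : ℝ) < t / 2 := by
        have : (0 : ℝ) < t := by exact_mod_cast ht
        linarith
      obtain ⟨δ, hδ, hδl⟩ := (mem_nhdsGT_iff_exists_Ioo_subset).1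
        (hl.eventually (Metric.ball_mem_nhds l ht'))
      refine ⟨δ, hδ, fun ε hε ε' hε' => ?_⟩
      have hdec : ∀ ε : ℝ, 0 < ε → (borelTransform σ (x + ε * Complex.I)).re =
          (borelTransform μ (x + ε * Complex.I)).re + (borelTransform τ (x + ε * Complex.I)).re -
          (borelTransform τ' (x + ε * Complex.I)).re := fun ε hε => by
        have hz : 0 < ((x : ℂ) + ε * Complex.I).im := by simpa using hε
        have h3 := borelTransform_add (σ := σ) τ' hz
        rw [heq, borelTransform_add τ hz] at h3
        have h4 := congrArg Complex.re h3
        simp only [Complex.add_re] at h4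
        linarith
      have e1 := abs_lt.1 (show |_| < _ from Real.dist_eq _ _ ▸ Metric.mem_ball.1 (hδl hε))
      have e2 := abs_lt.1 (show |_| < _ from Real.dist_eq _ _ ▸ Metric.mem_ball.1 (hδl hε'))
      have e3 := abs_le.1 ((Complex.abs_re_le_norm _).trans (h1 ε hε.1))
      have e4 := abs_le.1 ((Complex.abs_re_le_norm _).trans (h1 ε' hε'.1))
      have e5 := abs_le.1 ((Complex.abs_re_le_norm _).trans (h2 ε hε.1))
      have e6 := abs_le.1 ((Complex.abs_re_le_norm _).trans (h2 ε' hε'.1))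
      rw [hdec ε hε.1, hdec ε' hε'.1, abs_le]
      constructor <;> linarith [e1.1, e1.2, e2.1, e2.2, e3.1, e3.2, e4.1, e4.2, e5.1, e5.2, e6.1,
        e6.2]
    calc volume B ≤ 0 + (1310720 * (t⁻¹ : ℝ≥0) * τ univ + 1310720 * (t⁻¹ : ℝ≥0) * τ' univ) := by
          refine (measure_mono hsub).trans ((measure_union_le _ _).trans (add_le_add ?_ ?_))
          · exact (ae_iff.1 hlim).le
          · exact (measure_union_le _ _).trans (add_le_add
              (volume_exists_lt_borelTransform_le τ ht) (volume_exists_lt_borelTransform_le τ' ht))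
      _ ≤ 0 + (1310720 * (t⁻¹ : ℝ≥0) * (2 * ENNReal.ofReal η) +
            1310720 * (t⁻¹ : ℝ≥0) * (2 * ENNReal.ofReal η)) := by gcongr
      _ = _ := by ring
  have hlim : Tendsto (fun η : ℝ => 5242880 * ((t⁻¹ : ℝ≥0) : ℝ≥0∞) * ENNReal.ofReal η) (𝓝[>] 0)
      (𝓝 0) := by
    have h1 : Tendsto (fun η : ℝ => ENNReal.ofReal η) (𝓝[>] 0) (𝓝 0) := by
      simpa using (ENNReal.continuous_ofReal.tendsto 0).mono_left (nhdsWithin_le_nhds (s := Ioi 0))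
    simpa using ENNReal.Tendsto.const_mul h1
      (Or.inr (ENNReal.mul_ne_top (by norm_num) ENNReal.coe_ne_top))
  exact le_antisymm (ge_of_tendsto hlim (by
    filter_upwards [self_mem_nhdsWithin] with η hη using key η hη)) zero_le

theorem ae_hasVerticalLimit (σ : Measure ℝ) [IsFiniteMeasure σ] :
    ∀ᵐ x, HasVerticalLimit σ x := by
  have h : ∀ n : ℕ, ∀ᵐ x : ℝ, ∃ δ : ℝ, 0 < δ ∧ ∀ ε ∈ Ioo 0 δ, ∀ ε' ∈ Ioo 0 δ,
      |(borelTransform σ (x + ε * Complex.I)).re - (borelTransform σ (x + ε' * Complex.I)).re| ≤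
        5 * ((1 / (n + 1) : ℝ≥0) : ℝ) := fun n =>
    ae_iff.2 (volume_oscillation_eq_zero σ (by positivity))
  filter_upwards [ae_all_iff.2 h] with x hx
  refine CompleteSpace.complete (Metric.cauchy_iff.2 ⟨inferInstance, fun r hr => ?_⟩)
  have hlim : Tendsto (fun n : ℕ => 5 * (1 / ((n : ℝ) + 1))) atTop (𝓝 0) := by
    simpa using tendsto_one_div_add_atTop_nhds_zero_nat.const_mul (5 : ℝ)
  obtain ⟨n, hn⟩ := (hlim.eventually (gt_mem_nhds hr)).exists
  obtain ⟨δ, hδ, hδx⟩ := hx n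
  refine ⟨_, image_mem_map (Ioo_mem_nhdsGT hδ), ?_⟩
  rintro _ ⟨ε, hε, rfl⟩ _ ⟨ε', hε', rfl⟩
  refine lt_of_le_of_lt (hδx ε hε ε' hε') ?_
  simpa using hn

/-- The principal value Hilbert transform exists almost everywhere, and together with the density
of `σ` it gives the vertical boundary values of the Borel transform. -/
theorem ae_tendsto_truncHilbert_and_borelTransform (σ : Measure ℝ) [IsFiniteMeasure σ] :
    ∀ᵐ x : ℝ, Tendsto (fun ε : ℝ => truncHilbert σ ε x) (𝓝[>] 0) (𝓝 (hilbertTransform σ x)) ∧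
      Tendsto (fun ε : ℝ => borelTransform σ (x + ε * Complex.I)) (𝓝[>] 0)
        (𝓝 (-hilbertTransform σ x + (σ.rnDeriv volume x).toReal * Complex.I)) := by
  filter_upwards [ae_hasVerticalLimit σ, ae_tendsto_borelTransform_im σ,
    ae_tendsto_borelTransform_re_add_truncHilbert σ] with x ⟨l, hl⟩ him hre
  have h1 : Tendsto (fun ε : ℝ => truncHilbert σ ε x) (𝓝[>] 0) (𝓝 (-l)) := by
    simpa using hre.sub hl
  have h2 : hilbertTransform σ x = -l := h1.limUnder_eq
  rw [h2]
  refine ⟨h1, ?_⟩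
  have h3 := ((Complex.continuous_ofReal.tendsto _).comp hl).add
    (((Complex.continuous_ofReal.tendsto _).comp him).mul_const Complex.I)
  push_cast
  rw [neg_neg]
  refine h3.congr fun ε => ?_
  exact Complex.re_add_im _

/-! ### Logarithmic comparisons on `[0, ∞]`. -/

theorem logOneAdd_ofReal {r : ℝ} (hr : 0 ≤ r) :
    logOneAdd (ENNReal.ofReal r) = ENNReal.ofReal (Real.log (1 + r)) := by
  rw [logOneAdd, ← ENNReal.ofReal_one, ← ENNReal.ofReal_add zero_le_one hr,
    ENNReal.log_ofReal_of_pos (by linarith), EReal.real_coe_toENNReal]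

theorem logOneAdd_mono : Monotone logOneAdd := fun a b h =>
  EReal.toENNReal_le_toENNReal (ENNReal.log_monotone (by gcongr))

theorem continuous_logOneAdd : Continuous logOneAdd :=
  EReal.continuous_toENNReal.comp (ENNReal.continuous_log.comp (continuous_const_add 1))

theorem inv_two_le_logOneAdd {t : ℝ≥0∞} (ht : 1 ≤ t) : 2⁻¹ ≤ logOneAdd t := by
  refine le_trans ?_ (logOneAdd_mono ht)
  rw [← ENNReal.ofReal_one, logOneAdd_ofReal zero_le_one,
    show (2⁻¹ : ℝ≥0∞) = ENNReal.ofReal 2⁻¹ by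
      rw [ENNReal.ofReal_inv_of_pos (by norm_num)]; norm_num]
  refine ENNReal.ofReal_le_ofReal ?_
  rw [one_add_one_eq_two]
  linarith [Real.log_two_gt_d9]

theorem le_two_mul_logOneAdd {t : ℝ≥0∞} (ht : t ≤ 1) : t ≤ 2 * logOneAdd t := by
  have hne : t ≠ ⊤ := ne_top_of_le_ne_top ENNReal.one_ne_top ht
  rw [← ENNReal.ofReal_toReal hne, logOneAdd_ofReal ENNReal.toReal_nonneg,
    show (2 : ℝ≥0∞) = ENNReal.ofReal 2 by norm_num, ← ENNReal.ofReal_mul (by norm_num)]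
  refine ENNReal.ofReal_le_ofReal (le_two_mul_log_one_add ENNReal.toReal_nonneg ?_)
  simpa using ENNReal.toReal_mono ENNReal.one_ne_top ht

theorem logOneAdd_eq_elog (H : ℝ) {r : ℝ≥0∞} (hr : r ≠ ⊤) :
    logOneAdd (‖H‖ₑ ^ 2 + r ^ 2) = elog (-H + r.toReal * Complex.I) := by
  have h1 : ‖(-H + r.toReal * Complex.I : ℂ)‖ ^ 2 = H ^ 2 + r.toReal ^ 2 := by
    rw [← Complex.normSq_eq_norm_sq, ← Complex.ofReal_neg, Complex.normSq_add_mul_I, neg_sq]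
  rw [elog, h1, ← logOneAdd_ofReal (by positivity), ENNReal.ofReal_add (by positivity)
    (by positivity), ENNReal.ofReal_pow ENNReal.toReal_nonneg, ENNReal.ofReal_toReal hr,
    ← sq_abs H, ENNReal.ofReal_pow (abs_nonneg H), ← ofReal_norm, Real.norm_eq_abs]

/-- Bernoulli's inequality `1 + 16 s ≤ (1 + s)^16` with `s = |w|²` moves the factor 4 outside the
logarithm. -/
theorem logOneAdd_four_mul_le_elog {w : ℂ} (hw : 0 ≤ w.im) :
    logOneAdd ((4 * ENNReal.ofReal w.im) ^ 2) ≤ 16 * elog w := by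
  rw [show (4 : ℝ≥0∞) = ENNReal.ofReal 4 by norm_num, ← ENNReal.ofReal_mul (by norm_num),
    ← ENNReal.ofReal_pow (by positivity), logOneAdd_ofReal (by positivity), elog,
    show (16 : ℝ≥0∞) = ENNReal.ofReal 16 by norm_num, ← ENNReal.ofReal_mul (by norm_num)]
  refine ENNReal.ofReal_le_ofReal ?_
  have h1 : w.im ^ 2 ≤ ‖w‖ ^ 2 := pow_le_pow_left₀ hw (Complex.im_le_norm w) 2
  calc Real.log (1 + (4 * w.im) ^ 2) ≤ Real.log ((1 + ‖w‖ ^ 2) ^ 16) := by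
        refine Real.log_le_log (by positivity) ?_
        have := one_add_mul_le_pow (a := ‖w‖ ^ 2) (by nlinarith [sq_nonneg ‖w‖]) 16
        push_cast at this
        nlinarith
    _ = _ := by rw [Real.log_pow]; norm_num

/-- Where `Mσ > 1` the left side is at most 4 and the logarithm at least 1/2; where `Mσ ≤ 1` the
square and its logarithm are comparable. -/
theorem maximalFunction_restrict_sq_le (σ : Measure ℝ) (x : ℝ) :
    maximalFunction (σ.restrict {x | 1 < maximalFunction σ x}ᶜ) x ^ 2 ≤
      8 * logOneAdd (maximalFunction σ x ^ 2) := by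
  rcases lt_or_ge 1 (maximalFunction σ x) with h | h
  · calc _ ≤ (2 : ℝ≥0∞) ^ 2 := pow_le_pow_left₀ zero_le (maximalFunction_restrict_le_two σ x) 2
      _ = 8 * 2⁻¹ := by
        rw [show (8 : ℝ≥0∞) = 2 ^ 2 * 2 by norm_num, mul_assoc,
          ENNReal.mul_inv_cancel (by norm_num) (by norm_num), mul_one]
      _ ≤ _ := by
        gcongr
        exact inv_two_le_logOneAdd (one_le_pow₀ h.le)
  · calc _ ≤ maximalFunction σ x ^ 2 :=
          pow_le_pow_left₀ zero_le (maximalFunction_mono Measure.restrict_le_self x) 2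
      _ ≤ 2 * logOneAdd (maximalFunction σ x ^ 2) := le_two_mul_logOneAdd (pow_le_one₀ zero_le h)
      _ ≤ _ := by gcongr; norm_num

/-! ### The two inequalities for finite measures. -/

section finite

variable (σ : Measure ℝ) [IsFiniteMeasure σ]

theorem logOneAdd_maximalFunction_le (x : ℝ) :
    logOneAdd (maximalFunction σ x ^ 2) ≤
      16 * ⨆ (ε : ℝ) (_ : 0 < ε), elog (borelTransform σ (x + ε * Complex.I)) := by
  set S := 16 * ⨆ (ε : ℝ) (_ : 0 < ε), elog (borelTransform σ (x + ε * Complex.I))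
  have hclosed : IsClosed {a : ℝ≥0∞ | logOneAdd (a ^ 2) ≤ S} :=
    isClosed_le (continuous_logOneAdd.comp (ENNReal.continuous_pow 2)) continuous_const
  -- The vertical supremum need not be attained, so the bound is shown for every `a < Mσ(x)` and
  -- extended by closedness. At `Mσ(x) = 0` there is no such `a`.
  rcases eq_or_ne (maximalFunction σ x) 0 with h0 | h0
  · rw [h0]
    have : logOneAdd (0 ^ 2) = 0 := by
      rw [zero_pow two_ne_zero, ← ENNReal.ofReal_zero, logOneAdd_ofReal le_rfl]
      simp
    rw [this]
    exact zero_le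
  refine (hclosed.closure_subset_iff (s := Iio (maximalFunction σ x))).2 (fun a ha => ?_) ?_
  · have h1 : a < _ := lt_of_lt_of_le ha (maximalFunction_le_iSup_borelTransform_im σ x)
    simp only [ENNReal.mul_iSup, lt_iSup_iff] at h1
    obtain ⟨ε, hε, h1⟩ := h1
    refine (logOneAdd_mono (pow_le_pow_left₀ zero_le h1.le 2)).trans ?_
    refine (logOneAdd_four_mul_le_elog (borelTransform_line_im_nonneg σ hε x)).trans ?_
    exact mul_le_mul_right (le_iSup₂ (f := fun (ε : ℝ) (_ : 0 < ε) =>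
      elog (borelTransform σ (x + ε * Complex.I))) ε hε) _
  · rw [closure_Iio' ⟨0, pos_iff_ne_zero.2 h0⟩]
    exact mem_Iic.2 le_rfl

theorem ae_tendsto_elog_borelTransform :
    ∀ᵐ x : ℝ, Tendsto (fun n : ℕ => elog (borelTransform σ (x + (1 / (n + 1) : ℝ) * Complex.I)))
      atTop (𝓝 (logOneAdd (‖hilbertTransform σ x‖ₑ ^ 2 + (σ.rnDeriv volume x) ^ 2))) := by
  filter_upwards [ae_tendsto_truncHilbert_and_borelTransform σ, Measure.rnDeriv_lt_top σ volume]
    with x ⟨_, hx⟩ hr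
  rw [logOneAdd_eq_elog _ hr.ne]
  have h1 : Tendsto (fun n : ℕ => (1 / (n + 1) : ℝ)) atTop (𝓝[>] 0) :=
    tendsto_nhdsWithin_iff.2 ⟨tendsto_one_div_add_atTop_nhds_zero_nat,
      Eventually.of_forall fun n => mem_Ioi.2 (by positivity)⟩
  exact (continuous_elog.tendsto _).comp (hx.comp h1)

/-- The mass of `σ` enters only qualitatively, to make the vertical supremum integrable for
dominated convergence; the final constant `16 · 327680` does not involve it. -/
theorem lintegral_logOneAdd_maximalFunction_le :
    ∫⁻ x, logOneAdd (maximalFunction σ x ^ 2) ≤ 5242880 *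
      ∫⁻ x, logOneAdd (‖hilbertTransform σ x‖ₑ ^ 2 + (σ.rnDeriv volume x) ^ 2) := by
  have hlim : Tendsto (fun n : ℕ =>
      ∫⁻ x : ℝ, elog (borelTransform σ (x + (1 / (n + 1) : ℝ) * Complex.I))) atTop
      (𝓝 (∫⁻ x, logOneAdd (‖hilbertTransform σ x‖ₑ ^ 2 + (σ.rnDeriv volume x) ^ 2))) := by
    refine tendsto_lintegral_of_dominated_convergence
      (fun x => ⨆ (ε : ℝ) (_ : 0 < ε), elog (borelTransform σ (x + ε * Complex.I)))
      (fun n => (continuous_elog.comp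
        (continuous_borelTransform_line σ (by positivity))).measurable)
      (fun n => ae_of_all _ fun x => ?_) ?_ (ae_tendsto_elog_borelTransform σ)
    · exact le_iSup₂ (f := fun (ε : ℝ) (_ : 0 < ε) =>
        elog (borelTransform σ (x + ε * Complex.I))) (1 / ((n : ℝ) + 1)) (by positivity)
    · exact ne_top_of_le_ne_top (ENNReal.mul_ne_top (by norm_num) (measure_ne_top σ univ))
        (lintegral_iSup_elog_le σ)
  calc _ ≤ ∫⁻ x : ℝ, 16 * ⨆ (ε : ℝ) (_ : 0 < ε), elog (borelTransform σ (x + ε * Complex.I)) :=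
        lintegral_mono fun x => logOneAdd_maximalFunction_le σ x
    _ ≤ 16 * (327680 *
          ∫⁻ x, logOneAdd (‖hilbertTransform σ x‖ₑ ^ 2 + (σ.rnDeriv volume x) ^ 2)) := by
        rw [lintegral_const_mul' _ _ (by norm_num)]
        exact mul_le_mul_right (lintegral_iSup_elog_le_of_tendsto σ hlim fun n => le_rfl) _
    _ = _ := by rw [← mul_assoc]; norm_num

theorem lintegral_enorm_sq_borelTransform_le {δ : ℝ} (hδ : 0 < δ) :
    ∫⁻ x : ℝ, ‖borelTransform σ (x + δ * Complex.I)‖ₑ ^ 2 ≤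
      512 * ∫⁻ x, maximalFunction σ x ^ 2 := by
  have hm := continuous_borelTransform_line σ hδ
  have h1 : ∀ w : ℂ, ‖w‖ₑ ^ 2 = ENNReal.ofReal (w.re ^ 2) + ENNReal.ofReal (w.im ^ 2) := fun w => by
    rw [← ofReal_norm, ← ENNReal.ofReal_pow (norm_nonneg _), ← Complex.normSq_eq_norm_sq,
      Complex.normSq_apply, ← ENNReal.ofReal_add (sq_nonneg _) (sq_nonneg _), sq, sq]
  simp_rw [h1]
  have hre : Measurable fun x : ℝ =>
      ENNReal.ofReal ((borelTransform σ (x + δ * Complex.I)).re ^ 2) :=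
    ((Complex.continuous_re.comp hm).pow 2).measurable.ennreal_ofReal
  rw [lintegral_add_left hre]
  calc _ ≤ 2 * ∫⁻ x : ℝ, ENNReal.ofReal ((borelTransform σ (x + δ * Complex.I)).im ^ 2) := by
        rw [two_mul]
        exact add_le_add (lintegral_re_sq_borelTransform_le σ hδ) le_rfl
    _ ≤ 2 * ∫⁻ x : ℝ, 256 * maximalFunction σ x ^ 2 := by
        gcongr with x
        rw [ENNReal.ofReal_pow (borelTransform_line_im_nonneg σ hδ x)]
        refine (pow_le_pow_left₀ zero_le (ofReal_borelTransform_im_le σ x hδ) 2).trans_eq ?_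
        rw [mul_pow]
        norm_num
    _ = _ := by
        rw [lintegral_const_mul' _ _ (by norm_num), ← mul_assoc]
        norm_num

theorem lintegral_elog_borelTransform_le_maximalFunction {δ : ℝ} (hδ : 0 < δ) :
    ∫⁻ x : ℝ, elog (borelTransform σ (x + δ * Complex.I)) ≤
      8248 * ∫⁻ x, logOneAdd (maximalFunction σ x ^ 2) := by
  set Ω := {x | 1 < maximalFunction σ x} with hΩ
  have hΩm : MeasurableSet Ω := (isOpen_lt_maximalFunction σ 1).measurableSet
  set J := ∫⁻ x, logOneAdd (maximalFunction σ x ^ 2) with hJ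
  -- Chebyshev: on `Ω` the integrand is at least `log 2 ≥ 1/2`.
  have hvol : volume Ω ≤ 2 * J := by
    have h1 : 2⁻¹ * volume Ω ≤ J := by
      rw [← lintegral_indicator_const hΩm]
      refine lintegral_mono fun x => ?_
      by_cases hx : x ∈ Ω
      · rw [indicator_of_mem hx]
        exact inv_two_le_logOneAdd (one_le_pow₀ (le_of_lt hx))
      · rw [indicator_of_notMem hx]
        exact zero_le
    calc volume Ω = 2 * (2⁻¹ * volume Ω) := by
          rw [← mul_assoc, ENNReal.mul_inv_cancel (by norm_num) (by norm_num), one_mul]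
      _ ≤ 2 * J := mul_le_mul_right h1 _
  have hgood : ∫⁻ x : ℝ, ‖borelTransform (σ.restrict Ωᶜ) (x + δ * Complex.I)‖ₑ ^ 2 ≤ 4096 * J := by
    refine (lintegral_enorm_sq_borelTransform_le (σ.restrict Ωᶜ) hδ).trans ?_
    calc _ ≤ 512 * ∫⁻ x, 8 * logOneAdd (maximalFunction σ x ^ 2) :=
          mul_le_mul_right (lintegral_mono fun x => maximalFunction_restrict_sq_le σ x) _
      _ = _ := by
          rw [lintegral_const_mul' _ _ (by norm_num), ← hJ, ← mul_assoc]
          norm_num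
  have hbad : ∫⁻ x : ℝ, elog (borelTransform (σ.restrict Ω) (x + δ * Complex.I)) ≤ 28 * J := by
    refine (lintegral_elog_borelTransform_le (σ.restrict Ω) hδ).trans ?_
    rw [Measure.restrict_apply MeasurableSet.univ, univ_inter]
    calc 2 * σ Ω ≤ 2 * (7 * (2 * J)) :=
          mul_le_mul_right ((measure_one_lt_maximalFunction_le σ).trans
            (mul_le_mul_right hvol _)) _
      _ = 28 * J := by rw [← mul_assoc, ← mul_assoc]; norm_num
  calc _ ≤ ∫⁻ x : ℝ, (2 * ‖borelTransform (σ.restrict Ωᶜ) (x + δ * Complex.I)‖ₑ ^ 2 +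
        2 * elog (borelTransform (σ.restrict Ω) (x + δ * Complex.I))) := by
        refine lintegral_mono fun x => ?_
        conv_lhs => rw [← Measure.restrict_compl_add_restrict (μ := σ) hΩm]
        rw [borelTransform_add (σ := σ.restrict Ωᶜ) _ (by simpa using hδ)]
        exact elog_add_le _ _
    _ ≤ 2 * (4096 * J) + 2 * (28 * J) := by
        rw [lintegral_add_left, lintegral_const_mul' _ _ (by norm_num),
          lintegral_const_mul' _ _ (by norm_num)]
        · gcongr
        · exact ((continuous_borelTransform_line _ hδ).enorm.measurable.pow_const 2).const_mul 2
    _ = 8248 * J := by rw [← mul_assoc, ← mul_assoc, ← add_mul]; norm_num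

theorem lintegral_logOneAdd_hilbertTransform_le :
    ∫⁻ x, logOneAdd (‖hilbertTransform σ x‖ₑ ^ 2 + (σ.rnDeriv volume x) ^ 2) ≤
      8248 * ∫⁻ x, logOneAdd (maximalFunction σ x ^ 2) := by
  calc _ = ∫⁻ x : ℝ, liminf (fun n : ℕ =>
        elog (borelTransform σ (x + (1 / (n + 1) : ℝ) * Complex.I))) atTop :=
        lintegral_congr_ae ((ae_tendsto_elog_borelTransform σ).mono fun x hx => hx.liminf_eq.symm)
    _ ≤ liminf (fun n : ℕ =>
        ∫⁻ x : ℝ, elog (borelTransform σ (x + (1 / (n + 1) : ℝ) * Complex.I))) atTop :=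
        lintegral_liminf_le fun n => (continuous_elog.comp
          (continuous_borelTransform_line σ (by positivity))).measurable
    _ ≤ liminf (fun _ : ℕ => 8248 * ∫⁻ x, logOneAdd (maximalFunction σ x ^ 2)) atTop :=
        liminf_le_liminf (Eventually.of_forall fun n =>
          lintegral_elog_borelTransform_le_maximalFunction σ (by positivity))
    _ = _ := by simp

end finite

/-- `σ` is a positive Borel measure, finite on compact sets, with compact support. The principal
value `Hσ` exists almost everywhere, and the two integrals (of nonnegative functions, with respect
to Lebesgue measure) are comparable with an absolute constant `C`. `σ.rnDeriv volume` is the density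
`dσ/dx` of the absolutely continuous part of `σ`. -/
theorem theorem10p4 :
    ∃ C : ℝ≥0, ∀ (σ : Measure ℝ) [IsLocallyFiniteMeasure σ], IsCompact σ.support →
      (∀ᵐ x : ℝ, Tendsto (fun ε : ℝ => truncHilbert σ ε x) (𝓝[>] (0 : ℝ))
        (𝓝 (hilbertTransform σ x))) ∧
      (∫⁻ x : ℝ, logOneAdd (‖hilbertTransform σ x‖ₑ ^ 2 + (σ.rnDeriv volume x) ^ 2)) ≤
        (C : ℝ≥0∞) * ∫⁻ x : ℝ, logOneAdd ((maximalFunction σ x) ^ 2) ∧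
      (∫⁻ x : ℝ, logOneAdd ((maximalFunction σ x) ^ 2)) ≤
        (C : ℝ≥0∞) *
          ∫⁻ x : ℝ, logOneAdd (‖hilbertTransform σ x‖ₑ ^ 2 + (σ.rnDeriv volume x) ^ 2) := by
  -- The larger of the two constants `5242880` and `8248`.
  refine ⟨5242880, fun σ _ hσ => ?_⟩
  have hfin : IsFiniteMeasure σ := by
    refine ⟨?_⟩
    rw [← union_compl_self σ.support]
    refine (measure_union_le _ _).trans_lt ?_
    rw [Measure.measure_compl_support, add_zero]
    exact hσ.measure_lt_top
  refine ⟨(ae_tendsto_truncHilbert_and_borelTransform σ).mono fun x hx => hx.1, ?_,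
    lintegral_logOneAdd_maximalFunction_le σ⟩
  refine (lintegral_logOneAdd_hilbertTransform_le σ).trans (mul_le_mul_left ?_ _)
  norm_num
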